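/- **Setting.** Let $G$ be a connected simple graph on the nodes $1,\dots,M$, $M\ge 2$, with edge set $\mathcal E$ and degrees $d_i$. Let $f_1,\dots,f_M:\mathbb R^S\to\mathbb R$ be differentiable with $\|\nabla f_i(y)-\nabla f_i(z)\|\le L_i\|y-z\|$ for all $y,z$, where $L_i>0$, and suppose that $f(x)=\frac1M\sum_{i=1}^M f_i(x_i)$, $x=(x_1,\dots,x_M)\in(\mathbb R^S)^M$, is bounded below; put $\underline f=\inf f$, $L=\mathrm{diag}(L_1,\dots,L_M)$, $\bar L=\frac1M\sum_i L_i$, $d_0=(\nabla f_1(0),\dots,\nabla f_M(0))$ and $\|d_0\|^2_{L^{-1}}=\sum_i L_i^{-1}\|\nabla f_i(0)\|^2$. Let $F\in\mathbb R^{\mathcal E\times M}$ be the matrix whose row for an edge $\{i,j\}$, $i>j$, has the entry $1$ at $i$, $-1$ at $j$ and $0$ elsewhere, and let $B=|F|$ entrywise. Matrices act on stacked vectors blockwise (as $\,\cdot\otimes I_S$). Write $\lambda_{\max}$ and $\underline\lambda_{\min}$ for the largest and the smallest nonzero eigenvalue of a symmetric matrix. **D-GPDA.** Given $\Sigma=\mathrm{diag}(\sigma_e)_{e\in\mathcal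 E}\succ0$ and $\Upsilon=\mathrm{diag}(\beta_1,\dots,\beta_M)\succ0$, let $\Delta=\mathrm{diag}\big(\sum_{j\sim i}\sigma_{ij}^2\big)_i$ and $H=B^T\Sigma^2B+\Upsilon^2$. The iterates are defined by $\nabla f(0)+(2\Delta+\Upsilon^2)x^0=0$, $\lambda^0=\Sigma^2Fx^0$ and, for $r\ge0$, $$x^{r+1}=\arg\min_x\ \langle\nabla f(x^r)+F^T\lambda^r,x-x^r\rangle+\tfrac12\|\Sigma Fx\|^2+\tfrac12\|\Sigma B(x-x^r)\|^2+\tfrac12\|\Upsilon(x-x^r)\|^2,\qquad \lambda^{r+1}=\lambda^r+\Sigma^2Fx^{r+1}.$$ For $T\ge1$ let $$e(T)=\min_{1\le r\le T}\Big(\Big\|\tfrac1M\sum_{i=1}^M\nabla f_i(x_i^r)\Big\|^2+\|\Sigma Fx^r\|^2\Big).$$ **Parameters.** Let $$\sigma_{ij}^2=\frac{\beta^2\sqrt{L_iL_j}}{\sqrt{d_id_j}},\qquad \Upsilon^2=\beta^2L,\qquad \beta^2=\frac{80\max\{\lambda_{\max}(W),1\}}{\min\{\underline\lambda_{\min}(\mathcal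 L_G),1\}\,M},$$ where $W=\Upsilon^{-1}\Delta\Upsilon^{-1}$ and $\mathcal L_G=\Upsilon^{-1}F^T\Sigma^2F\Upsilon^{-1}$. These two matrices do not depend on the value of $\beta^2$: $W$ is diagonal with $$W_{ii}=[\mathcal L_G]_{ii}=\frac{1}{\sqrt{L_id_i}}\sum_{q\sim i}\frac{\sqrt{L_q}}{\sqrt{d_q}},\qquad [\mathcal L_G]_{ij}=-\frac1{\sqrt{d_id_j}}\ (i\sim j),\qquad [\mathcal L_G]_{ij}=0\ \text{otherwise}.$$ **Theorem.** For these parameters, with $\kappa=1/\underline\lambda_{\min}(\Sigma FH^{-1}F^T\Sigma)$ and $c=\max\{6\kappa,1\}$, the descent conditions $$\Upsilon^2\succeq\frac{L\Upsilon^{-2}L}{M^2},\qquad \frac12(\Delta+\Upsilon^2)-\frac LM-\frac{4\kappa}{M^2}L\Upsilon^{-2}L-\frac{2c}{M}L\succeq0$$ hold. Further, let $C_2=4\sum_{\{i,j\}\in\mathcal E}\sigma_{ij}^2+\sum_{i=1}^M\beta_i^2+4$ and, for $\epsilon>0$, $$N_\epsilon=\frac8\epsilon\Big(f(x^0)-\underline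 f+\frac2M\|d_0\|^2_{L^{-1}}\Big)C_2 .$$ Then for every $\epsilon>0$ there is an integer $T$ with $1\le T\le\max\{1,N_\epsilon\}$ and $e(T)\le\epsilon$, and $e(T)\le\epsilon$ holds for every integer $T\ge1$ with $T\ge N_\epsilon$. Moreover $$C_2=\frac{320\max\{\lambda_{\max}(W),1\}}{\min\{\underline\lambda_{\min}(\mathcal L_G),1\}}\Big(\sum_{\{i,j\}\in\mathcal E}\frac{\sqrt{L_iL_j}}{\sqrt{d_id_j}\,M}+\frac{\bar L}4\Big)+4\ \le\ \frac{320\max\{\lambda_{\max}(W),1\}}{\min\{\underline\lambda_{\min}(\mathcal L_G),1\}}\sum_{\{i,j\}\in\mathcal E}\Big(\frac{\sqrt{L_iL_j}}{\sqrt{d_id_j}\,M}+\frac{\bar L}4\Big)+4 .$$ -/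

import Mathlib

open scoped Matrix

noncomputable section

namespace DGPDA

/-! ### Extreme eigenvalues of a real symmetric matrix -/

/-- The largest eigenvalue of a real symmetric matrix. -/
def lamMax {n : Type*} [Fintype n] [DecidableEq n] (A : Matrix n n ℝ) : ℝ :=
  sSup (spectrum ℝ A)

/-- The smallest nonzero eigenvalue of a (nonzero) real symmetric matrix. -/
def lamMinNZ {n : Type*} [Fintype n] [DecidableEq n] (A : Matrix n n ℝ) : ℝ :=
  sInf {μ : ℝ | μ ∈ spectrum ℝ A ∧ μ ≠ 0}

/-! ### Stacked vectors: one vector of `ℝ^S` for every node (or for every edge) -/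

/-- The action of `A ⊗ I_S` on a stacked vector. -/
def act {m n : Type*} [Fintype n] {S : ℕ} (A : Matrix m n ℝ)
    (x : n → EuclideanSpace ℝ (Fin S)) : m → EuclideanSpace ℝ (Fin S) :=
  fun i => ∑ j, A i j • x j

/-- The Euclidean inner product of stacked vectors. -/
def dot {n : Type*} [Fintype n] {S : ℕ} (x y : n → EuclideanSpace ℝ (Fin S)) : ℝ :=
  ∑ i, inner ℝ (x i) (y i)

/-- The squared Euclidean norm of a stacked vector. -/
def sqNorm {n : Type*} [Fintype n] {S : ℕ} (x : n → EuclideanSpace ℝ (Fin S)) : ℝ :=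
  ∑ i, ‖x i‖ ^ 2

/-! ### The problem -/

/-- The objective `f(x) = (1/M) ∑ᵢ fᵢ(xᵢ)` on stacked vectors. -/
def obj {M S : ℕ} (f : Fin M → EuclideanSpace ℝ (Fin S) → ℝ)
    (x : Fin M → EuclideanSpace ℝ (Fin S)) : ℝ :=
  (1 / (M : ℝ)) * ∑ i, f i (x i)

/-- The gradient of `obj f`: its `i`-th block is `∇fᵢ(xᵢ) / M`. -/
def gradObj {M S : ℕ} (f : Fin M → EuclideanSpace ℝ (Fin S) → ℝ)
    (x : Fin M → EuclideanSpace ℝ (Fin S)) : Fin M → EuclideanSpace ℝ (Fin S) :=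
  fun i => (1 / (M : ℝ)) • gradient (f i) (x i)

/-! ### Graph matrices.  Nodes are `Fin M`, edges are the elements of `G.edgeSet`; the edge
weights `σ` and node weights `β` are the diagonals of `Σ` and `Υ`. -/

section Graph

variable {M : ℕ} (G : SimpleGraph (Fin M)) [DecidableRel G.Adj]

/-- The scaled incidence matrix `F`: the row of the edge `{i, j}`, `i > j`, has the entry `1` at
`i` and `-1` at `j`. -/
def incF : Matrix G.edgeSet (Fin M) ℝ :=
  fun e v => if v = e.1.sup then 1 else if v = e.1.inf then -1 else 0

/-- `B = |F|`, entrywise. -/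
def incB : Matrix G.edgeSet (Fin M) ℝ := (incF G).map fun a => |a|

/-- The diagonal matrix `Δ` with entries `∑_{j ∼ i} σ_{ij}²`. -/
def deltaMat (σ : G.edgeSet → ℝ) : Matrix (Fin M) (Fin M) ℝ :=
  Matrix.diagonal fun i => ∑ e : G.edgeSet, if i ∈ e.1 then σ e ^ 2 else 0

/-- `H = Bᵀ Σ² B + Υ²`. -/
def matH (σ : G.edgeSet → ℝ) (β : Fin M → ℝ) : Matrix (Fin M) (Fin M) ℝ :=
  (incB G)ᵀ * Matrix.diagonal σ ^ 2 * incB G + Matrix.diagonal β ^ 2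

/-- The generalized Laplacian `Υ⁻¹ Fᵀ Σ² F Υ⁻¹`. -/
def genLaplacian (σ : G.edgeSet → ℝ) (β : Fin M → ℝ) : Matrix (Fin M) (Fin M) ℝ :=
  (Matrix.diagonal β)⁻¹ * (incF G)ᵀ * Matrix.diagonal σ ^ 2 * incF G * (Matrix.diagonal β)⁻¹

/-- `κ`, the reciprocal of the smallest nonzero eigenvalue of `Σ F H⁻¹ Fᵀ Σ`. -/
def kappa (σ : G.edgeSet → ℝ) (β : Fin M → ℝ) : ℝ :=
  1 / lamMinNZ
    (Matrix.diagonal σ * incF G * (matH G σ β)⁻¹ * (incF G)ᵀ * Matrix.diagonal σ)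

/-! ### The algorithm -/

variable {S : ℕ}

/-- The function minimized in the primal step, at the current primal iterate `xr` and the current
dual iterate `lr`. -/
def primalObj (f : Fin M → EuclideanSpace ℝ (Fin S) → ℝ) (σ : G.edgeSet → ℝ) (β : Fin M → ℝ)
    (xr : Fin M → EuclideanSpace ℝ (Fin S)) (lr : G.edgeSet → EuclideanSpace ℝ (Fin S))
    (x : Fin M → EuclideanSpace ℝ (Fin S)) : ℝ :=
  dot (gradObj f xr + act (incF G)ᵀ lr) (x - xr)
    + 1 / 2 * sqNorm (act (Matrix.diagonal σ * incF G) x)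
    + 1 / 2 * sqNorm (act (Matrix.diagonal σ * incB G) (x - xr))
    + 1 / 2 * sqNorm (act (Matrix.diagonal β) (x - xr))

/-- `x r`, `lam r`, `r = 0, 1, 2, …`, are the primal and dual iterates of D-GPDA with parameters
`σ`, `β`.  The iterates of index `-1` are `0`; they enter through `∇f(0)` only. -/
structure IsDGPDA (f : Fin M → EuclideanSpace ℝ (Fin S) → ℝ) (σ : G.edgeSet → ℝ)
    (β : Fin M → ℝ) (x : ℕ → Fin M → EuclideanSpace ℝ (Fin S))
    (lam : ℕ → G.edgeSet → EuclideanSpace ℝ (Fin S)) : Prop where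
  init_primal :
    gradObj f 0 + act ((2 : ℝ) • deltaMat G σ + Matrix.diagonal β ^ 2) (x 0) = 0
  init_dual : lam 0 = act (Matrix.diagonal σ ^ 2 * incF G) (x 0)
  primal : ∀ r, IsMinOn (primalObj G f σ β (x r) (lam r)) Set.univ (x (r + 1))
  dual : ∀ r, lam (r + 1) = lam r + act (Matrix.diagonal σ ^ 2 * incF G) (x (r + 1))

/-- `‖(1/M) ∑ᵢ ∇fᵢ(xᵢ)‖² + ‖Σ F x‖²`. -/
def gap (f : Fin M → EuclideanSpace ℝ (Fin S) → ℝ) (σ : G.edgeSet → ℝ)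
    (x : Fin M → EuclideanSpace ℝ (Fin S)) : ℝ :=
  ‖(1 / (M : ℝ)) • ∑ i, gradient (f i) (x i)‖ ^ 2
    + sqNorm (act (Matrix.diagonal σ * incF G) x)

/-- `e(T)`, the minimum of the gap over the iterates `1, …, T`; only meant for `1 ≤ T`. -/
def errorMeasure (f : Fin M → EuclideanSpace ℝ (Fin S) → ℝ) (σ : G.edgeSet → ℝ)
    (x : ℕ → Fin M → EuclideanSpace ℝ (Fin S)) (T : ℕ) : ℝ :=
  ⨅ r : Finset.Icc 1 T, gap G f σ (x r)

/-! ### The choice of parameters.  `L i` is the Lipschitz constant of `∇fᵢ`; the argument `b2` is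
the scalar `β²`. -/

/-- `√(L_i L_j) / √(d_i d_j)` for the edge `e = {i, j}`. -/
def edgeWeight (L : Fin M → ℝ) (e : G.edgeSet) : ℝ :=
  √(L e.1.inf * L e.1.sup) / √((G.degree e.1.inf : ℝ) * (G.degree e.1.sup : ℝ))

/-- `σ_{ij}`, where `σ_{ij}² = β² √(L_i L_j) / √(d_i d_j)`. -/
def sigmaPar (L : Fin M → ℝ) (b2 : ℝ) (e : G.edgeSet) : ℝ := √(b2 * edgeWeight G L e)

/-- `β_i`, where `β_i² = β² L_i`, that is `Υ² = β² L`. -/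
def betaPar (L : Fin M → ℝ) (b2 : ℝ) (i : Fin M) : ℝ := √(b2 * L i)

/-- The generalized Laplacian of the chosen parameters.  It does not depend on `β²` (see
`genLaplacian_par`), so it is written down for `β² = 1`. -/
def matLG (L : Fin M → ℝ) : Matrix (Fin M) (Fin M) ℝ :=
  genLaplacian G (sigmaPar G L 1) (betaPar L 1)

/-- The diagonal matrix `W = Υ⁻¹ Δ Υ⁻¹` of the chosen parameters, which does not depend on `β²`
either: `W_ii = (1 / √(L_i d_i)) ∑_{q ∼ i} √L_q / √d_q`. -/
def matW (L : Fin M → ℝ) : Matrix (Fin M) (Fin M) ℝ :=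
  Matrix.diagonal fun i => 1 / √(L i * (G.degree i : ℝ)) *
    ∑ q ∈ G.neighborFinset i, √(L q) / √(G.degree q : ℝ)

/-- `β² = 80 max{λ_max(W), 1} / (min{λ_min(L_G), 1} M)`, with `λ_min` the smallest nonzero
eigenvalue. -/
def betaSq (L : Fin M → ℝ) : ℝ :=
  80 * max (lamMax (matW G L)) 1 / (min (lamMinNZ (matLG G L)) 1 * (M : ℝ))

/-- `C₂ = 4 ∑_{(i,j) : i ∼ j} σ_{ij}² + ∑ᵢ β_i² + 4`; the first sum runs over the edges. -/
def constC2 (σ : G.edgeSet → ℝ) (β : Fin M → ℝ) : ℝ :=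
  4 * ∑ e, σ e ^ 2 + ∑ i, β i ^ 2 + 4

theorem genLaplacian_par (L : Fin M → ℝ) (hL : ∀ i, 0 < L i) (b2 : ℝ) (hb : 0 < b2) :
    genLaplacian G (sigmaPar G L b2) (betaPar L b2) = matLG G L := by
  have hs : Matrix.diagonal (sigmaPar G L b2) ^ 2
      = b2 • Matrix.diagonal (sigmaPar G L 1) ^ 2 := by
    have hw : ∀ e, 0 ≤ edgeWeight G L e := fun e => by unfold edgeWeight; positivity
    rw [Matrix.diagonal_pow, Matrix.diagonal_pow, ← Matrix.diagonal_smul]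
    congr 1
    funext e
    simp [sigmaPar, Real.sq_sqrt (mul_nonneg hb.le (hw e)), Real.sq_sqrt (hw e)]
  have hu : (Matrix.diagonal (betaPar L b2))⁻¹
      = (√b2)⁻¹ • (Matrix.diagonal (betaPar L 1))⁻¹ := by
    have h0 : ∀ c : ℝ, 0 < c → (Matrix.diagonal (betaPar L c))⁻¹
        = Matrix.diagonal fun i => (betaPar L c i)⁻¹ := fun c hc => by
      refine Matrix.inv_eq_right_inv ?_
      rw [Matrix.diagonal_mul_diagonal, ← Matrix.diagonal_one]
      congr 1
      funext i
      exact mul_inv_cancel₀ (Real.sqrt_pos.2 (mul_pos hc (hL i))).ne'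
    rw [h0 b2 hb, h0 1 one_pos, ← Matrix.diagonal_smul]
    congr 1
    funext i
    simp [betaPar, Real.sqrt_mul hb.le, mul_comm]
  have hc : (√b2)⁻¹ * ((√b2)⁻¹ * b2) = 1 := by
    have := Real.sqrt_pos.2 hb
    field_simp
    exact (Real.sq_sqrt hb.le).symm
  unfold matLG genLaplacian
  rw [hs, hu]
  simp only [Matrix.smul_mul, Matrix.mul_smul, smul_smul]
  rw [show (√b2)⁻¹ * (b2 * (√b2)⁻¹) = 1 by rw [← hc]; ring, one_smul]

end Graph

end DGPDA

end

/-! Write P for the weighted Laplacian `weightedLap` and y for the running sum of the primal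
iterates. The dual iterates are Σ²F y, so the primal step is the stationarity equation ∇f(xʳ) + P y
+ H(xʳ⁺¹ - xʳ) = 0, with y = x⁰ + ⋯ + xʳ⁺¹. Since P + H = 2Δ + Υ² (`weightedLap_add_matH`), the
initialization is the same equation with previous iterate 0.

Subtracting consecutive equations expresses P xʳ⁺¹ by a gradient difference and H applied to a
second difference of the iterates. In the norm of Υ⁻², the nonzero spectrum of the generalized
Laplacian bounds P xʳ⁺¹ from below and the bound H ≤ P + H = 2Δ + Υ² controls the H term from above.
Hence the constraint violation is dominated by the second difference
(`dot_weightedLap_le_of_stationary`). The augmented Lagrangian, which the dual step raises by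
exactly this violation, therefore becomes a decreasing potential once a multiple of a quadratic
whose decrease contains the second difference is added (`potential_step`).

The potential need not obviously be bounded below, because of its multiplier term; but that term
telescopes, and a decreasing sequence cannot stay below inf f without driving a nonnegative quantity
to -∞ (`le_potential`, `le_of_antitone_of_sub_le`). So violations and squared H-increments are
summable. Summing the stationarity equation over the nodes removes P, and Cauchy-Schwarz for H turns
these quantities into the gap, with constant C₂ (`gap_le`, `sum_gap_le`). The minimum over 1, …, T
is at most the average.

The descent conditions compare diagonal matrices and need only κ ≤ 3m, where m is `condNum`
(`kappa_le`). -/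

namespace DGPDA

/-! ### Linear algebra and quadratic forms on stacked vectors -/

section Stacked

variable {l m n : Type*} [Fintype m] [Fintype n] {S : ℕ}

theorem act_add (A : Matrix l n ℝ) (x y : n → EuclideanSpace ℝ (Fin S)) :
    act A (x + y) = act A x + act A y := by
  funext i
  simp [act, smul_add, Finset.sum_add_distrib]

theorem act_smul (A : Matrix l n ℝ) (t : ℝ) (x : n → EuclideanSpace ℝ (Fin S)) :
    act A (t • x) = t • act A x := by
  funext i
  simp [act, Finset.smul_sum, smul_comm t]

theorem act_sub (A : Matrix l n ℝ) (x y : n → EuclideanSpace ℝ (Fin S)) :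
    act A (x - y) = act A x - act A y := by
  funext i
  simp [act, smul_sub]

theorem add_act (A B : Matrix l n ℝ) (x : n → EuclideanSpace ℝ (Fin S)) :
    act (A + B) x = act A x + act B x := by
  funext i
  simp [act, add_smul, Finset.sum_add_distrib]

theorem sub_act (A B : Matrix l n ℝ) (x : n → EuclideanSpace ℝ (Fin S)) :
    act (A - B) x = act A x - act B x := by
  funext i
  simp [act, sub_smul, Finset.sum_sub_distrib]

theorem smul_act (t : ℝ) (A : Matrix l n ℝ) (x : n → EuclideanSpace ℝ (Fin S)) :
    act (t • A) x = t • act A x := by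
  funext i
  simp [act, Finset.smul_sum, smul_smul]

theorem act_mul (A : Matrix l m ℝ) (B : Matrix m n ℝ) (x : n → EuclideanSpace ℝ (Fin S)) :
    act (A * B) x = act A (act B x) := by
  funext i
  simp only [act, Matrix.mul_apply, Finset.sum_smul, Finset.smul_sum, smul_smul]
  exact Finset.sum_comm

theorem act_diagonal [DecidableEq n] (d : n → ℝ) (x : n → EuclideanSpace ℝ (Fin S)) :
    act (Matrix.diagonal d) x = fun i => d i • x i := by
  funext i
  simp [act, Matrix.diagonal_apply]

theorem one_act [DecidableEq n] (x : n → EuclideanSpace ℝ (Fin S)) :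
    act (1 : Matrix n n ℝ) x = x := by
  rw [← Matrix.diagonal_one, act_diagonal]
  simp

theorem dot_comm (x y : n → EuclideanSpace ℝ (Fin S)) : dot x y = dot y x :=
  Finset.sum_congr rfl fun _ _ => real_inner_comm _ _

theorem dot_add_right (x y z : n → EuclideanSpace ℝ (Fin S)) :
    dot x (y + z) = dot x y + dot x z := by
  simp [dot, inner_add_right, Finset.sum_add_distrib]

theorem dot_add_left (x y z : n → EuclideanSpace ℝ (Fin S)) :
    dot (x + y) z = dot x z + dot y z := by
  simp [dot, inner_add_left, Finset.sum_add_distrib]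

theorem dot_sub_right (x y z : n → EuclideanSpace ℝ (Fin S)) :
    dot x (y - z) = dot x y - dot x z := by
  simp [dot, inner_sub_right, Finset.sum_sub_distrib]

theorem dot_sub_left (x y z : n → EuclideanSpace ℝ (Fin S)) :
    dot (x - y) z = dot x z - dot y z := by
  simp [dot, inner_sub_left, Finset.sum_sub_distrib]

theorem dot_smul_right (t : ℝ) (x y : n → EuclideanSpace ℝ (Fin S)) :
    dot x (t • y) = t * dot x y := by
  simp [dot, inner_smul_right, Finset.mul_sum]

theorem dot_smul_left (t : ℝ) (x y : n → EuclideanSpace ℝ (Fin S)) :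
    dot (t • x) y = t * dot x y := by
  rw [dot_comm, dot_smul_right, dot_comm]

theorem dot_zero_right (x : n → EuclideanSpace ℝ (Fin S)) : dot x 0 = 0 := by
  simp [dot]

theorem dot_self (x : n → EuclideanSpace ℝ (Fin S)) : dot x x = sqNorm x := by
  simp [dot, sqNorm]

theorem sqNorm_nonneg (x : n → EuclideanSpace ℝ (Fin S)) : 0 ≤ sqNorm x :=
  Finset.sum_nonneg fun _ _ => sq_nonneg _

theorem sqNorm_eq_zero {x : n → EuclideanSpace ℝ (Fin S)} (h : sqNorm x = 0) : x = 0 := by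
  funext i
  have := (Finset.sum_eq_zero_iff_of_nonneg fun _ _ => sq_nonneg _).1 h i (Finset.mem_univ i)
  simpa using this

theorem sqNorm_add (x y : n → EuclideanSpace ℝ (Fin S)) :
    sqNorm (x + y) = sqNorm x + 2 * dot x y + sqNorm y := by
  rw [← dot_self, ← dot_self, ← dot_self, dot_add_left, dot_add_right, dot_add_right, dot_comm y x]
  ring

theorem dot_act_left (A : Matrix m n ℝ) (x : n → EuclideanSpace ℝ (Fin S))
    (y : m → EuclideanSpace ℝ (Fin S)) : dot (act A x) y = dot x (act Aᵀ y) := by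
  simp only [dot, act, sum_inner, inner_sum, inner_smul_left, inner_smul_right,
    Matrix.transpose_apply]
  exact Finset.sum_comm

theorem sqNorm_act (A : Matrix m n ℝ) (x : n → EuclideanSpace ℝ (Fin S)) :
    sqNorm (act A x) = dot x (act (Aᵀ * A) x) := by
  rw [← dot_self, dot_act_left, act_mul]

theorem dot_act_diagonal [DecidableEq n] (d : n → ℝ) (x : n → EuclideanSpace ℝ (Fin S)) :
    dot x (act (Matrix.diagonal d) x) = ∑ i, d i * ‖x i‖ ^ 2 := by
  simp [act_diagonal, dot, inner_smul_right]

/-- A positive semidefinite matrix acts as a positive semidefinite form on stacked vectors. -/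
theorem dot_act_nonneg {P : Matrix n n ℝ} (hP : P.PosSemidef)
    (x : n → EuclideanSpace ℝ (Fin S)) : 0 ≤ dot x (act P x) := by
  classical
  obtain ⟨C, rfl⟩ : ∃ C : Matrix n n ℝ, P = Cᵀ * C := by
    open scoped MatrixOrder in
    obtain ⟨C, hC⟩ := CStarAlgebra.nonneg_iff_eq_star_mul_self.1 hP.nonneg
    exact ⟨C, by simpa [Matrix.star_eq_conjTranspose] using hC⟩
  rw [← sqNorm_act]
  exact sqNorm_nonneg _

theorem dot_act_symm {P : Matrix n n ℝ} (hP : Pᵀ = P) (x y : n → EuclideanSpace ℝ (Fin S)) :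
    dot x (act P y) = dot y (act P x) := by
  rw [dot_comm, dot_act_left, hP]

/-- The Cauchy-Schwarz inequality for a positive semidefinite form on stacked vectors. -/
theorem dot_act_sq_le {P : Matrix n n ℝ} (hP : P.PosSemidef)
    (x y : n → EuclideanSpace ℝ (Fin S)) :
    dot x (act P y) ^ 2 ≤ dot x (act P x) * dot y (act P y) := by
  have hs : Pᵀ = P := by simpa using hP.isHermitian.eq
  -- The form at x + t y is a nonnegative quadratic polynomial in t.
  have h := discrim_le_zero (a := dot y (act P y)) (b := 2 * dot x (act P y))
    (c := dot x (act P x)) fun t => by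
      have := dot_act_nonneg hP (x + t • y)
      rw [act_add, act_smul, dot_add_left, dot_add_right, dot_add_right, dot_smul_left,
        dot_smul_right, dot_smul_left, dot_smul_right, dot_act_symm hs y x] at this
      linarith
  unfold discrim at h
  nlinarith

end Stacked


/-! ### Extreme eigenvalues -/

section Spectrum

variable {n : Type*} [Fintype n] [DecidableEq n]

theorem le_lamMax {A : Matrix n n ℝ} {μ : ℝ} (hμ : μ ∈ spectrum ℝ A) : μ ≤ lamMax A :=
  le_csSup A.finite_real_spectrum.bddAbove hμ

theorem lamMinNZ_le {A : Matrix n n ℝ} {μ : ℝ} (hμ : μ ∈ spectrum ℝ A) (h0 : μ ≠ 0) :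
    lamMinNZ A ≤ μ :=
  csInf_le (A.finite_real_spectrum.subset fun _ h => h.1).bddBelow ⟨hμ, h0⟩

theorem nonneg_of_mem_spectrum {A : Matrix n n ℝ} (hA : A.PosSemidef) {μ : ℝ}
    (hμ : μ ∈ spectrum ℝ A) : 0 ≤ μ := by
  rw [hA.isHermitian.spectrum_real_eq_range_eigenvalues] at hμ
  obtain ⟨i, rfl⟩ := hμ
  exact hA.eigenvalues_nonneg i

theorem lamMinNZ_pos {A : Matrix n n ℝ} (hA : A.PosSemidef) (h0 : A ≠ 0) : 0 < lamMinNZ A := by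
  have hne : {μ : ℝ | μ ∈ spectrum ℝ A ∧ μ ≠ 0}.Nonempty := by
    have := mt hA.isHermitian.eigenvalues_eq_zero_iff.1 h0
    obtain ⟨i, hi⟩ := Function.ne_iff.1 this
    exact ⟨_, hA.isHermitian.eigenvalues_mem_spectrum_real i, hi⟩
  have hmem := hne.csInf_mem (A.finite_real_spectrum.subset fun _ h => h.1)
  exact lt_of_le_of_ne (nonneg_of_mem_spectrum hA hmem.1) (Ne.symm hmem.2)

/-- Every nonzero eigenvalue of `A` is at least `lamMinNZ A`, hence `A² - lamMinNZ A • A` is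
positive semidefinite. -/
theorem posSemidef_sq_sub_lamMinNZ {A : Matrix n n ℝ} (hA : A.PosSemidef) :
    (A * A - lamMinNZ A • A).PosSemidef := by
  have hH := hA.isHermitian
  open scoped MatrixOrder in
  have hA' : IsSelfAdjoint A := hH
  have h : A * A - lamMinNZ A • A = cfc (fun t : ℝ => t * t - lamMinNZ A * t) A := by
    rw [cfc_sub _ _ A, cfc_mul _ _ A, cfc_const_mul _ _ A, cfc_id' ℝ A]
  rw [h, ← Matrix.nonneg_iff_posSemidef]
  refine cfc_nonneg fun t ht => ?_
  have h1 := nonneg_of_mem_spectrum hA ht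
  by_cases h0 : t = 0
  · simp [h0]
  · nlinarith [lamMinNZ_le ht h0]

/-- If every nonzero eigenvalue of `A` is at least `a`, then `1 / lamMinNZ A ≤ 1 / a`. -/
theorem one_div_lamMinNZ_le {A : Matrix n n ℝ} {a : ℝ} (ha : 0 < a)
    (h : ∀ μ ≠ 0, ∀ v : n → ℝ, v ≠ 0 → A *ᵥ v = μ • v → a ≤ μ) : 1 / lamMinNZ A ≤ 1 / a := by
  rcases Set.eq_empty_or_nonempty {μ : ℝ | μ ∈ spectrum ℝ A ∧ μ ≠ 0} with he | hne
  -- Without nonzero eigenvalues the infimum is `sInf ∅ = 0`, and `1 / 0 = 0`.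
  · rw [lamMinNZ, he]
    simp [ha.le]
  · refine one_div_le_one_div_of_le ha (le_csInf hne ?_)
    rintro μ ⟨hμ, h0⟩
    rw [← Matrix.spectrum_toLin', ← Module.End.hasEigenvalue_iff_mem_spectrum] at hμ
    obtain ⟨v, hv⟩ := hμ.exists_hasEigenvector
    exact h μ h0 v hv.2 (by simpa using hv.apply_eq_smul)

end Spectrum

/-! ### Incidence matrices and the chosen weights -/

section Graph

variable {M : ℕ} (G : SimpleGraph (Fin M))

theorem inf_ne_sup (e : G.edgeSet) : e.1.inf ≠ e.1.sup := by
  obtain ⟨e, he⟩ := e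
  induction e with | _ a b =>
  have : a ≠ b := G.ne_of_adj he
  simpa [Sym2.inf_mk, Sym2.sup_mk] using this

theorem mem_edge_iff (e : G.edgeSet) (i : Fin M) : i ∈ e.1 ↔ i = e.1.sup ∨ i = e.1.inf := by
  obtain ⟨e, he⟩ := e
  induction e with | _ a b =>
  rcases le_total a b with h | h <;> simp [Sym2.inf_mk, Sym2.sup_mk, h, or_comm]

theorem adj_inf_sup (e : G.edgeSet) : G.Adj e.1.inf e.1.sup := by
  obtain ⟨e, he⟩ := e
  induction e with | _ a b =>
  rcases le_total a b with h | h <;> simp [Sym2.inf_mk, Sym2.sup_mk, h]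
  · exact he
  · exact he.symm

theorem incF_eq (e : G.edgeSet) (v : Fin M) :
    incF G e v = (if v = e.1.sup then 1 else 0) - if v = e.1.inf then 1 else 0 := by
  have := inf_ne_sup G e
  unfold incF
  split_ifs <;> simp_all

theorem incB_eq (e : G.edgeSet) (v : Fin M) :
    incB G e v = (if v = e.1.sup then 1 else 0) + if v = e.1.inf then 1 else 0 := by
  have := inf_ne_sup G e
  simp only [incB, Matrix.map_apply, incF]
  split_ifs <;> simp_all

theorem sum_incF (e : G.edgeSet) : ∑ v, incF G e v = 0 := by
  simp [incF_eq]

theorem sum_incB (e : G.edgeSet) : ∑ v, incB G e v = 2 := by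
  simp [incB_eq, Finset.sum_add_distrib]; norm_num

/-- Off the diagonal the two products cancel, and on the diagonal both equal 1 at an endpoint of the
edge. This is why the signed and signless Laplacians add up to a diagonal matrix. -/
theorem incF_mul_add_incB_mul (e : G.edgeSet) (i j : Fin M) :
    incF G e i * incF G e j + incB G e i * incB G e j
      = if i = j then (if i ∈ e.1 then 2 else 0) else 0 := by
  have := inf_ne_sup G e
  rw [incF_eq, incF_eq, incB_eq, incB_eq]
  simp only [mem_edge_iff]
  split_ifs <;> simp_all <;> norm_num

theorem exists_edge (hM : 2 ≤ M) (hG : G.Connected) : Nonempty G.edgeSet := by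
  have : Nontrivial (Fin M) := Fin.nontrivial_iff_two_le.2 hM
  obtain ⟨v⟩ := hG.nonempty
  obtain ⟨w, hw⟩ := hG.preconnected.exists_adj_of_nontrivial v
  exact ⟨⟨s(v, w), hw⟩⟩

variable [DecidableRel G.Adj]

/-- The weighted Laplacian `Fᵀ Σ² F`. -/
def weightedLap (σ : G.edgeSet → ℝ) : Matrix (Fin M) (Fin M) ℝ :=
  (incF G)ᵀ * Matrix.diagonal σ ^ 2 * incF G

theorem weightedLap_eq (σ : G.edgeSet → ℝ) : weightedLap G σ =
    (Matrix.diagonal σ * incF G)ᵀ * (Matrix.diagonal σ * incF G) := by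
  rw [weightedLap, Matrix.transpose_mul, Matrix.diagonal_transpose, pow_two]
  simp only [Matrix.mul_assoc]

theorem signless_eq (σ : G.edgeSet → ℝ) : (incB G)ᵀ * Matrix.diagonal σ ^ 2 * incB G =
    (Matrix.diagonal σ * incB G)ᵀ * (Matrix.diagonal σ * incB G) := by
  rw [Matrix.transpose_mul, Matrix.diagonal_transpose, pow_two]
  simp only [Matrix.mul_assoc]

theorem weightedLap_add_matH (σ : G.edgeSet → ℝ) (β : Fin M → ℝ) :
    weightedLap G σ + matH G σ β = (2 : ℝ) • deltaMat G σ + Matrix.diagonal β ^ 2 := by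
  rw [matH, ← add_assoc]
  congr 1
  ext i j
  have h (C : Matrix G.edgeSet (Fin M) ℝ) :
      (Cᵀ * Matrix.diagonal σ ^ 2 * C : Matrix (Fin M) (Fin M) ℝ) i j = ∑ e, C e i * C e j * σ e ^ 2 := by
    rw [Matrix.diagonal_pow, Matrix.mul_apply]
    refine Finset.sum_congr rfl fun e _ => ?_
    rw [Matrix.mul_diagonal, Matrix.transpose_apply, Pi.pow_apply]
    ring
  rw [weightedLap, Matrix.add_apply, h, h, ← Finset.sum_add_distrib, deltaMat, Matrix.smul_apply,
    Matrix.diagonal_apply]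
  simp only [← add_mul, incF_mul_add_incB_mul]
  split_ifs with hij
  · rw [smul_eq_mul, Finset.mul_sum]
    refine Finset.sum_congr rfl fun e _ => ?_
    split_ifs <;> ring
  · simp

theorem weightedLap_posSemidef (σ : G.edgeSet → ℝ) : (weightedLap G σ).PosSemidef := by
  rw [weightedLap_eq]
  simpa using Matrix.posSemidef_conjTranspose_mul_self (Matrix.diagonal σ * incF G)

theorem matH_posSemidef (σ : G.edgeSet → ℝ) (β : Fin M → ℝ) : (matH G σ β).PosSemidef := by
  rw [matH, signless_eq]
  refine Matrix.PosSemidef.add ?_ ?_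
  · simpa using Matrix.posSemidef_conjTranspose_mul_self (Matrix.diagonal σ * incB G)
  · rw [Matrix.diagonal_pow]
    exact Matrix.PosSemidef.diagonal fun i => sq_nonneg (β i)

theorem sum_incident_eq {φ : Sym2 (Fin M) → ℝ} (i : Fin M) :
    (∑ e : G.edgeSet, if i ∈ e.1 then φ e.1 else 0) = ∑ q ∈ G.neighborFinset i, φ s(i, q) := by
  rw [← Finset.sum_filter]
  refine (Finset.sum_bij (fun q hq => ⟨s(i, q), (G.mem_neighborFinset i q).1 hq⟩) ?_ ?_ ?_ ?_).symm
  · intro q hq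
    simp
  · intro q hq r hr h
    exact Sym2.congr_right.1 (Subtype.ext_iff.1 h)
  · rintro ⟨e, he⟩ h
    simp only [Finset.mem_filter, Finset.mem_univ, true_and] at h
    obtain ⟨q, rfl⟩ := Sym2.mem_iff_exists.1 h
    exact ⟨q, (G.mem_neighborFinset i q).2 he, rfl⟩
  · intros; rfl

section Parameters

variable (L : Fin M → ℝ) (b2 : ℝ)

theorem sigmaPar_sq (hb : 0 ≤ b2) (e : G.edgeSet) :
    sigmaPar G L b2 e ^ 2 = b2 * edgeWeight G L e :=
  Real.sq_sqrt (mul_nonneg hb (by unfold edgeWeight; positivity))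

theorem betaPar_sq {L : Fin M → ℝ} (hL : ∀ i, 0 < L i) {b2 : ℝ} (hb : 0 ≤ b2) (i : Fin M) :
    betaPar L b2 i ^ 2 = b2 * L i :=
  Real.sq_sqrt (mul_nonneg hb (hL i).le)

theorem betaPar_pos {L : Fin M → ℝ} (hL : ∀ i, 0 < L i) {b2 : ℝ} (hb : 0 < b2) (i : Fin M) :
    0 < betaPar L b2 i :=
  Real.sqrt_pos.2 (mul_pos hb (hL i))

/-- Scaled by β², this is Δ = ΥWΥ for the chosen parameters; it lets the largest eigenvalue of W
bound Δ by a multiple of Υ². -/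
theorem sum_edgeWeight_incident {L : Fin M → ℝ} (hL : ∀ i, 0 < L i) (i : Fin M) :
    (∑ e : G.edgeSet, if i ∈ e.1 then edgeWeight G L e else 0) = L i * matW G L i i := by
  refine (sum_incident_eq G (φ := fun z : Sym2 (Fin M) => √(L z.inf * L z.sup) /
    √((G.degree z.inf : ℝ) * (G.degree z.sup : ℝ))) i).trans ?_
  rw [matW, Matrix.diagonal_apply_eq, ← mul_assoc, Finset.mul_sum]
  refine Finset.sum_congr rfl fun q _ => ?_
  have h : √(L i * L q) / √((G.degree i : ℝ) * (G.degree q : ℝ)) =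
      L i * (1 / √(L i * (G.degree i : ℝ))) * (√(L q) / √(G.degree q : ℝ)) := by
    rw [Real.sqrt_mul (hL i).le, Real.sqrt_mul (Nat.cast_nonneg _), Real.sqrt_mul (hL i).le]
    have h1 := Real.sqrt_pos.2 (hL i)
    have h2 : L i = √(L i) * √(L i) := (Real.mul_self_sqrt (hL i).le).symm
    have h3 : L i * (1 / (√(L i) * √(G.degree i : ℝ))) = √(L i) / √(G.degree i : ℝ) := by
      nth_rewrite 1 [h2]
      rw [mul_one_div, mul_div_mul_left _ _ h1.ne']
    rw [h3, div_mul_div_comm]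
  rw [← h]
  rcases le_total i q with hq | hq
  · have h1 : s(i, q).inf = i := by simp [Sym2.inf_mk, hq]
    have h2 : s(i, q).sup = q := by simp [Sym2.sup_mk, hq]
    rw [h1, h2]
  · have h1 : s(i, q).inf = q := by simp [Sym2.inf_mk, hq]
    have h2 : s(i, q).sup = i := by simp [Sym2.sup_mk, hq]
    rw [h1, h2, mul_comm (L q), mul_comm (G.degree q : ℝ)]

theorem deltaMat_par_le {L : Fin M → ℝ} (hL : ∀ i, 0 < L i) {b2 : ℝ} (hb : 0 ≤ b2) (i : Fin M) :
    deltaMat G (sigmaPar G L b2) i i ≤ lamMax (matW G L) * (b2 * L i) := by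
  have h1 : deltaMat G (sigmaPar G L b2) i i = b2 * (L i * matW G L i i) := by
    rw [← sum_edgeWeight_incident G hL, deltaMat, Matrix.diagonal_apply_eq, Finset.mul_sum]
    refine Finset.sum_congr rfl fun e _ => ?_
    rw [sigmaPar_sq G L b2 hb, mul_ite, mul_zero]
  have h2 : matW G L i i ≤ lamMax (matW G L) := le_lamMax (by
    rw [matW, spectrum_diagonal, Matrix.diagonal_apply_eq]
    exact ⟨i, rfl⟩)
  rw [h1]
  nlinarith [mul_nonneg hb (hL i).le]

theorem edgeWeight_pos {L : Fin M → ℝ} (hL : ∀ i, 0 < L i) (e : G.edgeSet) :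
    0 < edgeWeight G L e := by
  have h := adj_inf_sup G e
  have h1 : 0 < G.degree e.1.inf := (G.degree_pos_iff_exists_adj _).2 ⟨_, h⟩
  have h2 : 0 < G.degree e.1.sup := (G.degree_pos_iff_exists_adj _).2 ⟨_, h.symm⟩
  have := hL e.1.inf
  have := hL e.1.sup
  unfold edgeWeight
  positivity

theorem genLaplacian_eq (σ : G.edgeSet → ℝ) {β : Fin M → ℝ} (hβ : ∀ i, 0 < β i) :
    genLaplacian G σ β = Matrix.diagonal (fun i => (β i)⁻¹) * weightedLap G σ *
      Matrix.diagonal (fun i => (β i)⁻¹) := by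
  have h : (Matrix.diagonal β)⁻¹ = Matrix.diagonal fun i => (β i)⁻¹ := by
    refine Matrix.inv_eq_right_inv ?_
    rw [Matrix.diagonal_mul_diagonal, ← Matrix.diagonal_one]
    congr 1
    funext i
    exact mul_inv_cancel₀ (hβ i).ne'
  rw [genLaplacian, h, weightedLap]
  simp only [Matrix.mul_assoc]

theorem genLaplacian_posSemidef (σ : G.edgeSet → ℝ) {β : Fin M → ℝ} (hβ : ∀ i, 0 < β i) :
    (genLaplacian G σ β).PosSemidef := by
  rw [genLaplacian_eq G σ hβ]
  simpa using (weightedLap_posSemidef G σ).conjTranspose_mul_mul_same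
    (Matrix.diagonal fun i => (β i)⁻¹)

theorem matLG_posSemidef {L : Fin M → ℝ} (hL : ∀ i, 0 < L i) : (matLG G L).PosSemidef :=
  genLaplacian_posSemidef G _ (betaPar_pos hL one_pos)

theorem lamMinNZ_matLG_pos (hM : 2 ≤ M) (hG : G.Connected) {L : Fin M → ℝ} (hL : ∀ i, 0 < L i) :
    0 < lamMinNZ (matLG G L) := by
  refine lamMinNZ_pos (matLG_posSemidef G hL) fun h0 => ?_
  obtain ⟨e⟩ := exists_edge G hM hG
  have hβ := betaPar_pos hL one_pos
  -- A diagonal entry at an endpoint of an edge is, up to positive factors, a sum of squares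
  -- containing the positive weight of that edge, so it cannot vanish.
  have h := congr_fun₂ h0 e.1.sup e.1.sup
  rw [matLG, genLaplacian_eq G _ hβ, Matrix.mul_diagonal, Matrix.diagonal_mul, Matrix.zero_apply,
    mul_eq_zero_iff_right (inv_pos.2 (hβ _)).ne', mul_eq_zero_iff_left (inv_pos.2 (hβ _)).ne',
    weightedLap_eq, Matrix.mul_apply] at h
  simp only [Matrix.transpose_apply, ← pow_two] at h
  have := (Finset.sum_eq_zero_iff_of_nonneg fun _ _ => sq_nonneg _).1 h e (Finset.mem_univ e)
  rw [Matrix.diagonal_mul, incF_eq, if_pos rfl, if_neg (inf_ne_sup G e).symm, sub_zero, mul_one,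
    sigmaPar_sq G L 1 zero_le_one, one_mul] at this
  exact (edgeWeight_pos G hL e).ne' this

end Parameters

end Graph

/-! ### Estimates for H, the Laplacian and κ in weighted norms -/

/-- The weighted squared norm `∑ᵢ Lᵢ ‖vᵢ‖²` of a stacked vector. -/
noncomputable def wSq {n : Type*} [Fintype n] {S : ℕ} (L : n → ℝ) (v : n → EuclideanSpace ℝ (Fin S)) : ℝ :=
  ∑ i, L i * ‖v i‖ ^ 2

theorem wSq_nonneg {n : Type*} [Fintype n] {S : ℕ} {L : n → ℝ} (hL : ∀ i, 0 ≤ L i)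
    (v : n → EuclideanSpace ℝ (Fin S)) : 0 ≤ wSq L v :=
  Finset.sum_nonneg fun i _ => mul_nonneg (hL i) (sq_nonneg _)

theorem wSq_smul {n : Type*} [Fintype n] {S : ℕ} (L : n → ℝ) (t : ℝ)
    (v : n → EuclideanSpace ℝ (Fin S)) : wSq L (t • v) = t ^ 2 * wSq L v := by
  simp only [wSq, Pi.smul_apply, norm_smul, mul_pow, Finset.mul_sum, Real.norm_eq_abs, sq_abs]
  exact Finset.sum_congr rfl fun _ _ => by ring

theorem wSq_add_le {n : Type*} [Fintype n] {S : ℕ} {L : n → ℝ} (hL : ∀ i, 0 ≤ L i)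
    (u v : n → EuclideanSpace ℝ (Fin S)) : wSq L (u + v) ≤ 2 * wSq L u + 2 * wSq L v := by
  simp only [wSq, Finset.mul_sum, ← Finset.sum_add_distrib]
  refine Finset.sum_le_sum fun i _ => ?_
  have h : ‖u i + v i‖ ^ 2 ≤ 2 * ‖u i‖ ^ 2 + 2 * ‖v i‖ ^ 2 := by
    nlinarith [norm_add_le (u i) (v i), norm_nonneg (u i + v i), sq_nonneg (‖u i‖ - ‖v i‖)]
  rw [Pi.add_apply]
  nlinarith [mul_le_mul_of_nonneg_left h (hL i)]

section Graph

variable {M S : ℕ} (G : SimpleGraph (Fin M)) [DecidableRel G.Adj]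

theorem sqNorm_incF (σ : G.edgeSet → ℝ) (v : Fin M → EuclideanSpace ℝ (Fin S)) :
    sqNorm (act (Matrix.diagonal σ * incF G) v) = dot v (act (weightedLap G σ) v) := by
  rw [sqNorm_act, weightedLap_eq]

theorem dot_matH (σ : G.edgeSet → ℝ) (β : Fin M → ℝ) (v : Fin M → EuclideanSpace ℝ (Fin S)) :
    dot v (act (matH G σ β) v) =
      sqNorm (act (Matrix.diagonal σ * incB G) v) + wSq (fun i => β i ^ 2) v := by
  rw [matH, signless_eq, add_act, dot_add_right, ← sqNorm_act, Matrix.diagonal_pow,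
    dot_act_diagonal]
  rfl

theorem sum_act_weightedLap (σ : G.edgeSet → ℝ) (v : Fin M → EuclideanSpace ℝ (Fin S)) :
    ∑ i, act (weightedLap G σ) v i = 0 := by
  rw [weightedLap, Matrix.mul_assoc, act_mul]
  simp only [act, Matrix.transpose_apply]
  rw [Finset.sum_comm]
  simp [← Finset.sum_smul, sum_incF]

/-- The sum of the blocks of `H v` is controlled by the `H`-norm of `v` and `1ᵀ H 1`. -/
theorem norm_sum_act_matH_sq_le (σ : G.edgeSet → ℝ) (β : Fin M → ℝ)
    (v : Fin M → EuclideanSpace ℝ (Fin S)) :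
    ‖∑ i, act (matH G σ β) v i‖ ^ 2 ≤
      (4 * ∑ e, σ e ^ 2 + ∑ i, β i ^ 2) * dot v (act (matH G σ β) v) := by
  have hH := matH_posSemidef G σ β
  set s := ∑ i, act (matH G σ β) v i with hs
  have h1 : dot (fun _ => s) (act (matH G σ β) v) = ‖s‖ ^ 2 := by
    rw [dot, ← inner_sum, ← hs, real_inner_self_eq_norm_sq]
  -- The constant test vector with value s gives 1ᵀH1 times ‖s‖²; the 4 is the square of the row sum
  -- 2 of B. After Cauchy-Schwarz one factor ‖s‖² cancels.
  have h2 : dot (fun _ => s) (act (matH G σ β) fun _ => s) =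
      (4 * ∑ e, σ e ^ 2 + ∑ i, β i ^ 2) * ‖s‖ ^ 2 := by
    rw [dot_matH, act_mul, act_diagonal, add_mul, wSq, Finset.sum_mul, mul_assoc, Finset.sum_mul,
      Finset.mul_sum]
    congr 1
    refine Finset.sum_congr rfl fun e _ => ?_
    have h : act (incB G) (fun _ => s) e = (2 : ℝ) • s := by
      rw [← sum_incB G e, Finset.sum_smul]
      rfl
    beta_reduce
    rw [h, norm_smul, norm_smul, mul_pow, mul_pow, Real.norm_eq_abs, sq_abs, Real.norm_ofNat]
    ring
  have h3 := dot_act_sq_le hH (fun _ => s) v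
  rw [h1, h2] at h3
  rcases (sq_nonneg ‖s‖).eq_or_lt with h0 | h0
  · rw [← h0]
    exact mul_nonneg (by positivity) (dot_act_nonneg hH v)
  · refine le_of_mul_le_mul_left ?_ h0
    linarith

section Parameters

variable {L : Fin M → ℝ} (hL : ∀ i, 0 < L i) {b2 : ℝ} (hb : 0 < b2)
include hL hb

theorem wSq_betaPar (v : Fin M → EuclideanSpace ℝ (Fin S)) :
    wSq (fun i => betaPar L b2 i ^ 2) v = b2 * wSq L v := by
  simp only [wSq, betaPar_sq hL hb.le, Finset.mul_sum, mul_assoc]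

theorem wSq_le_dot_matH (v : Fin M → EuclideanSpace ℝ (Fin S)) :
    b2 * wSq L v ≤ dot v (act (matH G (sigmaPar G L b2) (betaPar L b2)) v) := by
  rw [dot_matH, wSq_betaPar hL hb]
  linarith [sqNorm_nonneg (act (Matrix.diagonal (sigmaPar G L b2) * incB G) v)]

/-- Adding the positive semidefinite P turns H into the diagonal matrix 2Δ + Υ², and Δ ≤ λ_max(W)
Υ². -/
theorem dot_matH_le (v : Fin M → EuclideanSpace ℝ (Fin S)) :
    dot v (act (matH G (sigmaPar G L b2) (betaPar L b2)) v) ≤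
      (2 * max (lamMax (matW G L)) 1 + 1) * (b2 * wSq L v) := by
  have h := congr_arg (fun A => dot v (act A v))
    (weightedLap_add_matH G (sigmaPar G L b2) (betaPar L b2))
  simp only [add_act, dot_add_right, smul_act, dot_smul_right, Matrix.diagonal_pow,
    dot_act_diagonal, deltaMat, Pi.pow_apply, betaPar_sq hL hb.le] at h
  have h1 := dot_act_nonneg (weightedLap_posSemidef G (sigmaPar G L b2)) v
  have h2 : ∑ i, (∑ e : G.edgeSet, if i ∈ e.1 then sigmaPar G L b2 e ^ 2 else 0) * ‖v i‖ ^ 2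
      ≤ lamMax (matW G L) * (b2 * wSq L v) := by
    rw [wSq, Finset.mul_sum, Finset.mul_sum]
    refine Finset.sum_le_sum fun i _ => ?_
    have := deltaMat_par_le G hL hb.le i
    rw [deltaMat, Matrix.diagonal_apply_eq] at this
    nlinarith [mul_le_mul_of_nonneg_right this (sq_nonneg ‖v i‖)]
  have h3 : ∑ i, b2 * L i * ‖v i‖ ^ 2 = b2 * wSq L v := by
    simp only [wSq, Finset.mul_sum, mul_assoc]
  have h4 := mul_le_mul_of_nonneg_right (le_max_left (lamMax (matW G L)) 1)
    (mul_nonneg hb.le (wSq_nonneg (fun i => (hL i).le) v))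
  linarith

/-- This is HΥ⁻²H ≤ cH, deduced from H ≤ cΥ²: Cauchy-Schwarz for H, tested with Υ⁻²Hv, bounds the
square of the left side by c times itself times the H-form of v. -/
theorem wSq_inv_act_matH_le (v : Fin M → EuclideanSpace ℝ (Fin S)) :
    wSq (fun i => (b2 * L i)⁻¹) (act (matH G (sigmaPar G L b2) (betaPar L b2)) v) ≤
      (2 * max (lamMax (matW G L)) 1 + 1) *
        dot v (act (matH G (sigmaPar G L b2) (betaPar L b2)) v) := by
  have hH := matH_posSemidef G (sigmaPar G L b2) (betaPar L b2)
  set H := matH G (sigmaPar G L b2) (betaPar L b2) with hHdef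
  set Q := wSq (fun i => (b2 * L i)⁻¹) (act H v) with hQ
  set y : Fin M → EuclideanSpace ℝ (Fin S) := fun i => (b2 * L i)⁻¹ • act H v i with hy
  have h1 : dot y (act H v) = Q := by
    simp [dot, hQ, wSq, hy, inner_smul_left]
  have h2 : b2 * wSq L y = Q := by
    rw [hQ, wSq, wSq, Finset.mul_sum]
    refine Finset.sum_congr rfl fun i _ => ?_
    have := mul_pos hb (hL i)
    have := hL i
    rw [hy, norm_smul, mul_pow, Real.norm_eq_abs, sq_abs]
    field_simp
  have h3 := dot_act_sq_le hH y v
  have h4 := dot_matH_le G hL hb y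
  rw [h2] at h4
  rw [h1] at h3
  have h5 := dot_act_nonneg hH v
  have h6 : 0 ≤ Q := wSq_nonneg (fun i => (inv_pos.2 (mul_pos hb (hL i))).le) _
  have h7 := mul_le_mul_of_nonneg_right h4 h5
  rcases h6.eq_or_lt with h0 | h0
  · rw [← h0]
    exact mul_nonneg (by linarith [le_max_right (lamMax (matW G L)) 1]) h5
  · refine le_of_mul_le_mul_left ?_ h0
    linarith

/-- Substituting z = Υv in A² ≥ λ A for the generalized Laplacian A gives PΥ⁻²P ≥ λP. -/
theorem lamMinNZ_mul_le (v : Fin M → EuclideanSpace ℝ (Fin S)) :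
    lamMinNZ (matLG G L) * dot v (act (weightedLap G (sigmaPar G L b2)) v) ≤
      wSq (fun i => (b2 * L i)⁻¹) (act (weightedLap G (sigmaPar G L b2)) v) := by
  have hβ := betaPar_pos hL hb
  set β := betaPar L b2 with hβdef
  set A := weightedLap G (sigmaPar G L b2)
  have hLG : matLG G L = Matrix.diagonal (fun i => (β i)⁻¹) * A *
      Matrix.diagonal (fun i => (β i)⁻¹) := by
    rw [← genLaplacian_par G L hL b2 hb, genLaplacian_eq G _ hβ]
  have hPSD := matLG_posSemidef G hL
  set z := act (Matrix.diagonal β) v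
  have hz : act (Matrix.diagonal fun i => (β i)⁻¹) z = v := by
    funext i
    simp [z, act_diagonal, smul_smul, inv_mul_cancel₀ (hβ i).ne']
  have h1 : act (matLG G L) z = act (Matrix.diagonal fun i => (β i)⁻¹) (act A v) := by
    rw [hLG, act_mul, act_mul, hz]
  have h := dot_act_nonneg (posSemidef_sq_sub_lamMinNZ hPSD) z
  have hs : (matLG G L)ᵀ = matLG G L := by simpa using hPSD.isHermitian.eq
  have h2 : dot z (act (matLG G L) z) = dot v (act A v) := by
    rw [h1, dot_comm, dot_act_left, Matrix.diagonal_transpose, hz, dot_comm]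
  have h3 : dot z (act (matLG G L * matLG G L) z) = wSq (fun i => (b2 * L i)⁻¹) (act A v) := by
    nth_rewrite 1 [← hs]
    rw [← sqNorm_act, h1, act_diagonal, sqNorm, wSq]
    refine Finset.sum_congr rfl fun i _ => ?_
    rw [norm_smul, mul_pow, Real.norm_eq_abs, sq_abs, ← betaPar_sq hL hb.le, inv_pow]
  rw [sub_act, smul_act, dot_sub_right, dot_smul_right, h2, h3] at h
  linarith

/-- For an eigenvector V with eigenvalue μ ≠ 0, the vector q = H⁻¹FᵀΣV solves Pq = μHq and has
H-form μ‖V‖². Comparing PΥ⁻²P ≥ λP with HΥ⁻²H ≤ cH at q yields μ ≥ λ/c. -/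
theorem kappa_par_le (hlam : 0 < lamMinNZ (matLG G L)) :
    kappa G (sigmaPar G L b2) (betaPar L b2) ≤
      (2 * max (lamMax (matW G L)) 1 + 1) / lamMinNZ (matLG G L) := by
  set σ := sigmaPar G L b2 with hσ
  set β := betaPar L b2 with hβ
  set w := max (lamMax (matW G L)) 1
  set lam := lamMinNZ (matLG G L)
  have hw : 0 < 2 * w + 1 := by linarith [le_max_right (lamMax (matW G L)) 1]
  have hH : IsUnit (matH G σ β).det := by
    have : (matH G σ β).PosDef := by
      rw [matH, signless_eq]
      refine Matrix.PosDef.posSemidef_add ?_ ?_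
      · simpa using Matrix.posSemidef_conjTranspose_mul_self (Matrix.diagonal σ * incB G)
      · rw [Matrix.diagonal_pow]
        exact Matrix.PosDef.diagonal fun i => pow_pos (betaPar_pos hL hb i) 2
    exact (Matrix.isUnit_iff_isUnit_det (matH G σ β)).1 this.isUnit
  rw [kappa, ← one_div_div lam]
  refine one_div_lamMinNZ_le (div_pos hlam hw) fun μ hμ v hv hN => ?_
  -- The scalar eigenvector becomes a stacked vector with one-dimensional blocks, so that the
  -- estimates above apply.
  let V : G.edgeSet → EuclideanSpace ℝ (Fin 1) := fun e => v e • EuclideanSpace.single 0 1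
  have hNV : act (Matrix.diagonal σ * incF G * (matH G σ β)⁻¹ * (incF G)ᵀ * Matrix.diagonal σ) V
      = μ • V := by
    funext e
    have := congr_fun hN e
    simp only [act, V, smul_smul, ← Finset.sum_smul, Pi.smul_apply]
    congr 1
  have hV : 0 < sqNorm V := by
    refine lt_of_le_of_ne (sqNorm_nonneg V) fun h => hv ?_
    have h0 := sqNorm_eq_zero h.symm
    funext e
    have := congr_fun h0 e
    simpa [V] using this
  set y := act ((Matrix.diagonal σ * incF G)ᵀ) V with hy
  set q := act (matH G σ β)⁻¹ y with hq
  have hHq : act (matH G σ β) q = y := by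
    rw [hq, ← act_mul, Matrix.mul_nonsing_inv _ hH, one_act]
  have hFq : act (Matrix.diagonal σ * incF G) q = μ • V := by
    rw [← hNV, hq, hy, ← act_mul, ← act_mul, Matrix.transpose_mul, Matrix.diagonal_transpose]
    simp only [Matrix.mul_assoc]
  have h1 : dot q (act (matH G σ β) q) = μ * sqNorm V := by
    rw [hHq, hy, ← dot_act_left, hFq, dot_smul_left, dot_self]
  have h2 : dot q (act (weightedLap G σ) q) = μ ^ 2 * sqNorm V := by
    rw [← sqNorm_incF, hFq, ← dot_self, dot_smul_left, dot_smul_right, dot_self]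
    ring
  have h3 : act (weightedLap G σ) q = μ • act (matH G σ β) q := by
    rw [weightedLap_eq, act_mul, hFq, act_smul, hHq]
  have h4 := lamMinNZ_mul_le G hL hb q
  rw [← hσ, h2, h3, wSq_smul] at h4
  have h5 := wSq_inv_act_matH_le G hL hb q
  rw [← hσ, ← hβ, h1] at h5
  have hμ2 : 0 < μ ^ 2 := by positivity
  have h7 : μ ^ 2 * (lam * sqNorm V) ≤ μ ^ 2 * ((2 * w + 1) * (μ * sqNorm V)) := by
    have := mul_le_mul_of_nonneg_left h5 hμ2.le
    linarith
  have h8 := le_of_mul_le_mul_left h7 hμ2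
  rw [div_le_iff₀ hw]
  refine le_of_mul_le_mul_right ?_ hV
  linarith

end Parameters
end Graph

/-! ### Smoothness of the objective -/

/-- The quadratic upper bound for a function with Lipschitz gradient. -/
theorem le_add_inner_gradient_add {E : Type*} [NormedAddCommGroup E] [InnerProductSpace ℝ E]
    [CompleteSpace E] {f : E → ℝ} (hf : Differentiable ℝ f) {K : ℝ}
    (hK : ∀ x z, ‖gradient f x - gradient f z‖ ≤ K * ‖x - z‖) (y z : E) :
    f y ≤ f z + inner ℝ (gradient f z) (y - z) + K / 2 * ‖y - z‖ ^ 2 := by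
  set v := y - z with hv
  -- The function along the ray from z, minus its quadratic model without the constant term; the
  -- Lipschitz bound makes its derivative nonpositive for t > 0.
  let φ : ℝ → ℝ := fun t => f (z + t • v) - t * inner ℝ (gradient f z) v - K / 2 * ‖v‖ ^ 2 * t ^ 2
  have hd (t : ℝ) : HasDerivAt φ (inner ℝ (gradient f (z + t • v)) v - inner ℝ (gradient f z) v
      - K / 2 * ‖v‖ ^ 2 * (2 * t)) t := by
    have h1 : HasDerivAt (fun t : ℝ => z + t • v) v t := by
      simpa using ((hasDerivAt_id t).smul_const v).const_add z
    have h2 : HasDerivAt (fun t : ℝ => f (z + t • v)) (inner ℝ (gradient f (z + t • v)) v) t := by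
      exact (hf (z + t • v)).hasGradientAt.hasFDerivAt.comp_hasDerivAt t h1
    have h3 := (hasDerivAt_id t).mul_const (inner ℝ (gradient f z) v)
    have h4 := (hasDerivAt_pow 2 t).const_mul (K / 2 * ‖v‖ ^ 2)
    exact ((h2.sub h3).sub h4).congr_deriv (by simp)
  have hanti : AntitoneOn φ (Set.Ici 0) := by
    refine antitoneOn_of_deriv_nonpos (convex_Ici 0)
      (fun t _ => (hd t).continuousAt.continuousWithinAt)
      (fun t _ => (hd t).differentiableAt.differentiableWithinAt) fun t ht => ?_
    rw [interior_Ici] at ht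
    have ht0 : (0 : ℝ) < t := ht
    rw [(hd t).deriv, ← inner_sub_left]
    have h1 := real_inner_le_norm (gradient f (z + t • v) - gradient f z) v
    have h2 := hK (z + t • v) z
    rw [add_sub_cancel_left, norm_smul, Real.norm_eq_abs, abs_of_pos ht0] at h2
    nlinarith [mul_le_mul_of_nonneg_right h2 (norm_nonneg v)]
  have h := hanti (Set.mem_Ici.2 le_rfl) (Set.mem_Ici.2 zero_le_one) zero_le_one
  simp only [φ, one_smul, zero_smul, add_zero, one_mul, zero_mul, one_pow, mul_one, sub_zero, hv,
    add_sub_cancel, ne_eq, OfNat.ofNat_ne_zero, not_false_eq_true, zero_pow, mul_zero] at h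
  linarith

section Objective

variable {M S : ℕ} {f : Fin M → EuclideanSpace ℝ (Fin S) → ℝ} {L : Fin M → ℝ}

theorem obj_le (hf : ∀ i, Differentiable ℝ (f i))
    (hLip : ∀ i x z, ‖gradient (f i) x - gradient (f i) z‖ ≤ L i * ‖x - z‖)
    (y z : Fin M → EuclideanSpace ℝ (Fin S)) :
    obj f y ≤ obj f z + dot (gradObj f z) (y - z) + 1 / 2 * (wSq L (y - z) / M) := by
  have h : ∑ i, f i (y i) ≤ ∑ i, (f i (z i) + inner ℝ (gradient (f i) (z i)) (y i - z i) +
      L i / 2 * ‖y i - z i‖ ^ 2) :=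
    Finset.sum_le_sum fun i _ => le_add_inner_gradient_add (hf i) (hLip i) _ _
  have h2 : ∑ i, L i / 2 * ‖y i - z i‖ ^ 2 = 1 / 2 * wSq L (y - z) := by
    rw [wSq, Finset.mul_sum]
    exact Finset.sum_congr rfl fun i _ => by rw [Pi.sub_apply]; ring
  have h3 : dot (gradObj f z) (y - z) =
      1 / (M : ℝ) * ∑ i, inner ℝ (gradient (f i) (z i)) (y i - z i) := by
    simp only [dot, gradObj, inner_smul_left, Finset.mul_sum, Pi.sub_apply]
    rfl
  rw [Finset.sum_add_distrib, Finset.sum_add_distrib, h2] at h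
  have := mul_le_mul_of_nonneg_left h (by positivity : (0 : ℝ) ≤ 1 / M)
  rw [obj, obj, h3]
  calc _ ≤ _ := this
    _ = _ := by ring

theorem neg_dot_gradObj_sub_le
    (hLip : ∀ i x z, ‖gradient (f i) x - gradient (f i) z‖ ≤ L i * ‖x - z‖) (hL : ∀ i, 0 < L i)
    (y z u : Fin M → EuclideanSpace ℝ (Fin S)) :
    -dot (gradObj f y - gradObj f z) u ≤ 1 / 2 * (wSq L (y - z) / M + wSq L u / M) := by
  have h : ∀ i, -inner ℝ (gradient (f i) (y i) - gradient (f i) (z i)) (u i) ≤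
      1 / 2 * (L i * ‖(y - z) i‖ ^ 2 + L i * ‖u i‖ ^ 2) := fun i => by
    have h1 := (abs_le.1 (abs_real_inner_le_norm
      (gradient (f i) (y i) - gradient (f i) (z i)) (u i))).1
    have h2 := mul_le_mul_of_nonneg_right (hLip i (y i) (z i)) (norm_nonneg (u i))
    rw [Pi.sub_apply]
    nlinarith [mul_nonneg (hL i).le (sq_nonneg (‖y i - z i‖ - ‖u i‖))]
  have h3 : dot (gradObj f y - gradObj f z) u =
      1 / (M : ℝ) * ∑ i, inner ℝ (gradient (f i) (y i) - gradient (f i) (z i)) (u i) := by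
    simp only [dot, gradObj, Pi.sub_apply, ← smul_sub, inner_smul_left, Finset.mul_sum]
    rfl
  have h4 := Finset.sum_le_sum fun i (_ : i ∈ Finset.univ) => h i
  rw [← Finset.mul_sum, Finset.sum_add_distrib, Finset.sum_neg_distrib] at h4
  have := mul_le_mul_of_nonneg_left h4 (by positivity : (0 : ℝ) ≤ 1 / M)
  rw [h3]
  calc _ = _ := by ring
    _ ≤ _ := this
    _ = _ := by simp only [wSq]; ring

theorem wSq_inv_gradObj_sub_le
    (hLip : ∀ i x z, ‖gradient (f i) x - gradient (f i) z‖ ≤ L i * ‖x - z‖) (hL : ∀ i, 0 < L i)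
    {b2 : ℝ} (hb : 0 < b2) (y z : Fin M → EuclideanSpace ℝ (Fin S)) :
    wSq (fun i => (b2 * L i)⁻¹) (gradObj f y - gradObj f z) ≤
      1 / (b2 * (M : ℝ) ^ 2) * wSq L (y - z) := by
  rw [wSq, wSq, Finset.mul_sum]
  refine Finset.sum_le_sum fun i _ => ?_
  have h1 : (gradObj f y - gradObj f z) i =
      (1 / (M : ℝ)) • (gradient (f i) (y i) - gradient (f i) (z i)) := by
    simp [gradObj, smul_sub]
  have h2 := pow_le_pow_left₀ (norm_nonneg _) (hLip i (y i) (z i)) 2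
  rw [h1, norm_smul, mul_pow, Real.norm_eq_abs, sq_abs, Pi.sub_apply]
  have hLi := hL i
  calc _ ≤ (b2 * L i)⁻¹ * ((1 / (M : ℝ)) ^ 2 * (L i * ‖y i - z i‖) ^ 2) := by gcongr
    _ = _ := by
      rw [mul_inv, mul_pow]
      field_simp

theorem neg_dot_gradObj_le (hL : ∀ i, 0 < L i) {t : ℝ} (ht : 0 < t)
    (z u : Fin M → EuclideanSpace ℝ (Fin S)) :
    -dot u (gradObj f z) ≤ t / 2 * (wSq L u / M) +
      1 / (2 * t) * (1 / (M : ℝ) * ∑ i, (L i)⁻¹ * ‖gradient (f i) (z i)‖ ^ 2) := by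
  have h : ∀ i, -inner ℝ (u i) (gradient (f i) (z i)) ≤
      t / 2 * (L i * ‖u i‖ ^ 2) + 1 / (2 * t) * ((L i)⁻¹ * ‖gradient (f i) (z i)‖ ^ 2) := fun i => by
    have h1 := (abs_le.1 (abs_real_inner_le_norm (u i) (gradient (f i) (z i)))).1
    have hLi := hL i
    set a := ‖u i‖
    set c := ‖gradient (f i) (z i)‖
    have h2 : t / 2 * (L i * a ^ 2) + 1 / (2 * t) * ((L i)⁻¹ * c ^ 2) - a * c =
        (t * L i * a - c) ^ 2 / (2 * t * L i) := by
      field_simp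
      ring
    have : 0 ≤ (t * L i * a - c) ^ 2 / (2 * t * L i) := by positivity
    linarith
  have h3 : dot u (gradObj f z) =
      1 / (M : ℝ) * ∑ i, inner ℝ (u i) (gradient (f i) (z i)) := by
    simp only [dot, gradObj, inner_smul_right, Finset.mul_sum]
  have h4 := Finset.sum_le_sum fun i (_ : i ∈ Finset.univ) => h i
  rw [Finset.sum_neg_distrib, Finset.sum_add_distrib, ← Finset.mul_sum, ← Finset.mul_sum] at h4
  have := mul_le_mul_of_nonneg_left h4 (by positivity : (0 : ℝ) ≤ 1 / M)
  rw [h3]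
  calc _ = _ := by ring
    _ ≤ _ := this
    _ = _ := by simp only [wSq]; ring

end Objective

/-! ### Stationarity equations of the iteration -/

section Recursion

variable {M S : ℕ} (G : SimpleGraph (Fin M)) [DecidableRel G.Adj]
  {f : Fin M → EuclideanSpace ℝ (Fin S) → ℝ} {σ : G.edgeSet → ℝ} {β : Fin M → ℝ}

/-- A quadratic polynomial that is minimal at `0` has no linear term. -/
theorem eq_zero_of_forall_quadratic_nonneg {a b : ℝ} (h : ∀ t : ℝ, 0 ≤ t * a + t ^ 2 * b) :
    a = 0 := by
  have := discrim_le_zero (a := b) (b := a) (c := 0) fun t => by linarith [h t, pow_two t]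
  unfold discrim at this
  nlinarith [sq_nonneg a]

theorem primal_stationary {xr y : Fin M → EuclideanSpace ℝ (Fin S)}
    {lr : G.edgeSet → EuclideanSpace ℝ (Fin S)}
    (h : IsMinOn (primalObj G f σ β xr lr) Set.univ y) :
    gradObj f xr + act (incF G)ᵀ lr + act (weightedLap G σ) y + act (matH G σ β) (y - xr) = 0 := by
  generalize hp : gradObj f xr + act (incF G)ᵀ lr = p
  set w := p + act (weightedLap G σ) y + act (matH G σ β) (y - xr) with hw
  refine sqNorm_eq_zero ?_
  -- Perturbing along the residual w itself makes the linear coefficient equal to the squared norm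
  -- of w.
  obtain ⟨b, hb⟩ : ∃ b, ∀ t : ℝ, primalObj G f σ β xr lr (y + t • w) =
      primalObj G f σ β xr lr y + (t * sqNorm w + t ^ 2 * b) := by
    refine ⟨1 / 2 * sqNorm (act (Matrix.diagonal σ * incF G) w)
      + 1 / 2 * sqNorm (act (Matrix.diagonal σ * incB G) w)
      + 1 / 2 * sqNorm (act (Matrix.diagonal β) w), fun t => ?_⟩
    have h1 : ∀ {m : Type} [Fintype m] (A : Matrix m (Fin M) ℝ)
        (z : Fin M → EuclideanSpace ℝ (Fin S)), sqNorm (act A (z + t • w)) =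
        sqNorm (act A z) + 2 * t * dot w (act (Aᵀ * A) z) + t ^ 2 * sqNorm (act A w) := by
      intro m _ A z
      rw [act_add, act_smul, sqNorm_add, dot_smul_right, dot_comm, dot_act_left, act_mul,
        ← dot_self (t • _), dot_smul_left, dot_smul_right, dot_self]
      ring
    have h2 : sqNorm w = dot w p + dot w (act (weightedLap G σ) y)
        + dot w (act (matH G σ β) (y - xr)) := by
      rw [← dot_self]
      nth_rewrite 2 [hw]
      rw [dot_add_right, dot_add_right]
    rw [weightedLap_eq, matH, signless_eq, add_act (_ * _), dot_add_right w (act (_ * _) _),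
        pow_two] at h2
    rw [primalObj, primalObj, hp, add_sub_right_comm, h1, h1, h1, dot_add_right, dot_smul_right,
      h2, dot_comm p w, Matrix.diagonal_transpose]
    ring
  refine eq_zero_of_forall_quadratic_nonneg (b := b) fun t => ?_
  have := isMinOn_univ_iff.1 h (y + t • w)
  rw [hb] at this
  linarith

/-- The running sum `x⁰ + ⋯ + x^{r-1}`, in terms of which the dual iterates are `Σ² F` times
a stacked vector. -/
def runningSum (x : ℕ → Fin M → EuclideanSpace ℝ (Fin S)) (r : ℕ) :
    Fin M → EuclideanSpace ℝ (Fin S) :=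
  ∑ s ∈ Finset.range r, x s

theorem runningSum_succ (x : ℕ → Fin M → EuclideanSpace ℝ (Fin S)) (r : ℕ) :
    runningSum x (r + 1) = runningSum x r + x r :=
  Finset.sum_range_succ _ _

variable {x : ℕ → Fin M → EuclideanSpace ℝ (Fin S)}
  {lam : ℕ → G.edgeSet → EuclideanSpace ℝ (Fin S)}

theorem IsDGPDA.dual_eq (hx : IsDGPDA G f σ β x lam) (r : ℕ) :
    lam r = act (Matrix.diagonal σ ^ 2 * incF G) (runningSum x (r + 1)) := by
  induction r with
  | zero => simp [hx.init_dual, runningSum]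
  | succ r ih => rw [hx.dual, ih, runningSum_succ x (r + 1), act_add]

theorem IsDGPDA.stationary_zero (hx : IsDGPDA G f σ β x lam) :
    gradObj f 0 + act (weightedLap G σ) (x 0) + act (matH G σ β) (x 0) = 0 := by
  rw [add_assoc, ← add_act, weightedLap_add_matH]
  exact hx.init_primal

theorem IsDGPDA.stationary_succ (hx : IsDGPDA G f σ β x lam) (r : ℕ) :
    gradObj f (x r) + act (weightedLap G σ) (runningSum x (r + 1) + x (r + 1))
      + act (matH G σ β) (x (r + 1) - x r) = 0 := by
  have h := primal_stationary G (hx.primal r)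
  rw [hx.dual_eq, ← act_mul, ← Matrix.mul_assoc] at h
  rw [act_add, ← add_assoc]
  exact h

end Recursion


/-! ### The potential: descent, lower bound, initial value -/

section Potential

variable {M S : ℕ} {f : Fin M → EuclideanSpace ℝ (Fin S) → ℝ} {L : Fin M → ℝ}
  {P H : Matrix (Fin M) (Fin M) ℝ} {m : ℝ}

/-- The potential of the primal-dual iteration: `y` is the running sum of the iterates, `x` the
current iterate, `d` the last increment, `P` the weighted Laplacian. -/
noncomputable def potential (f : Fin M → EuclideanSpace ℝ (Fin S) → ℝ) (L : Fin M → ℝ)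
    (P H : Matrix (Fin M) (Fin M) ℝ) (m : ℝ) (y x d : Fin M → EuclideanSpace ℝ (Fin S)) : ℝ :=
  obj f x + dot y (act P x) + 1 / 2 * dot x (act P x)
    + 9 * m * (dot x (act P x) + dot d (act H d) + wSq L d / M) + 3 / 80 * (wSq L d / M)

/-- The augmented Lagrangian part can grow by the new violation s. The quadratic weighted by 9m
supplies -9m times the second difference in H; by `hmul` multiplied by 3/2 this is at most -(3/2)s
plus 3/80 of the old increment term, which the last summand of the potential pays for. That leaves
-s/2. The new increment terms have coefficient 18m + 1/2 + 3/80 ≤ 40m, so half of the H-increment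
absorbs them. -/
theorem potential_step (hf : ∀ i, Differentiable ℝ (f i)) (hL : ∀ i, 0 < L i)
    (hLip : ∀ i x z, ‖gradient (f i) x - gradient (f i) z‖ ≤ L i * ‖x - z‖)
    (hP : P.PosSemidef) (hH : H.PosSemidef) (hm : 1 ≤ m)
    (hHL : ∀ v : Fin M → EuclideanSpace ℝ (Fin S), 80 * m * (wSq L v / M) ≤ dot v (act H v))
    {x₀ x₁ x₂ y : Fin M → EuclideanSpace ℝ (Fin S)}
    (h₁ : gradObj f x₀ + act P y + act H (x₁ - x₀) = 0)
    (h₂ : gradObj f x₁ + act P (y + x₂) + act H (x₂ - x₁) = 0)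
    (hmul : dot x₂ (act P x₂) ≤ 6 * m * dot (x₂ - x₁ - (x₁ - x₀)) (act H (x₂ - x₁ - (x₁ - x₀)))
      + 1 / 40 * (wSq L (x₁ - x₀) / M)) :
    potential f L P H m (y + x₂) x₂ (x₂ - x₁) ≤ potential f L P H m y x₁ (x₁ - x₀)
      - 1 / 2 * dot x₂ (act P x₂) - 1 / 2 * dot (x₂ - x₁) (act H (x₂ - x₁)) := by
  have hPt : Pᵀ = P := by simpa using hP.isHermitian.eq
  have hHt : Hᵀ = H := by simpa using hH.isHermitian.eq
  have hobj := obj_le hf hLip x₂ x₁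
  have hgrad := neg_dot_gradObj_sub_le hLip hL x₁ x₀ (x₂ - x₁)
  have hP0 := dot_act_nonneg hP (x₂ - x₁)
  have e₁ : dot (x₂ - x₁) (gradObj f x₀) + dot (x₂ - x₁) (act P y)
      + dot (x₂ - x₁) (act H (x₁ - x₀)) = 0 := by
    rw [← dot_add_right, ← dot_add_right, h₁, dot_zero_right]
  have e₂ : dot (x₂ - x₁) (gradObj f x₁) + dot (x₂ - x₁) (act P (y + x₂))
      + dot (x₂ - x₁) (act H (x₂ - x₁)) = 0 := by
    rw [← dot_add_right, ← dot_add_right, h₂, dot_zero_right]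
  have hw := hHL (x₂ - x₁)
  have hw0 : 0 ≤ wSq L (x₂ - x₁) / M := div_nonneg (wSq_nonneg (fun i => (hL i).le) _) (by simp)
  rw [dot_comm] at hobj
  rw [dot_comm, dot_sub_right] at hgrad
  unfold potential
  generalize x₁ - x₀ = d₁ at *
  have hd : dot (x₂ - x₁ - d₁) (act H (x₂ - x₁ - d₁)) = dot (x₂ - x₁) (act H (x₂ - x₁))
      - 2 * dot (x₂ - x₁) (act H d₁) + dot d₁ (act H d₁) := by
    rw [act_sub, dot_sub_left, dot_sub_right, dot_sub_right,
      dot_act_symm hHt d₁ (x₂ - x₁)]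
    ring
  have hx : dot (x₂ - x₁) (act P (x₂ - x₁)) =
      dot x₂ (act P x₂) - 2 * dot x₁ (act P x₂) + dot x₁ (act P x₁) := by
    rw [act_sub, dot_sub_left, dot_sub_right, dot_sub_right,
      dot_act_symm hPt x₂ x₁]
    ring
  have hy : dot (x₂ - x₁) (act P y) = dot y (act P x₂) - dot y (act P x₁) := by
    rw [dot_sub_left, dot_act_symm hPt x₂, dot_act_symm hPt x₁]
  have hx₂ : dot (x₂ - x₁) (act P x₂) = dot x₂ (act P x₂) - dot x₁ (act P x₂) := dot_sub_left _ _ _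
  rw [act_add, dot_add_right] at e₂
  rw [dot_add_left]
  generalize x₂ - x₁ = d₂ at *
  -- Pair the difference of the two stationarity equations with the new increment and polarize both
  -- quadratic forms; `hgrad` bounds the gradient term.
  have key : dot x₂ (act P x₂) + dot d₂ (act H d₂) + wSq L d₂ / M
      ≤ dot x₁ (act P x₁) + dot d₁ (act H d₁) + wSq L d₁ / M + 2 * (wSq L d₂ / M)
        - dot (d₂ - d₁) (act H (d₂ - d₁)) := by
    linarith
  have hm0 : 0 ≤ 9 * m := by linarith
  have key' := mul_le_mul_of_nonneg_left key hm0
  have hwm := mul_le_mul_of_nonneg_right hm hw0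
  linarith

/-- The multiplier term and half of the violation form a difference of two squares in the seminorm
of P, hence telescope along the running sums. -/
theorem le_potential (hL : ∀ i, 0 < L i) (hP : P.PosSemidef) (hH : H.PosSemidef) (hm : 0 ≤ m)
    (hbdd : BddBelow (Set.range (obj f))) (y x d : Fin M → EuclideanSpace ℝ (Fin S)) :
    (⨅ z, obj f z) + 1 / 2 * dot (y + x) (act P (y + x)) - 1 / 2 * dot y (act P y) ≤
      potential f L P H m (y + x) x d := by
  have hPt : Pᵀ = P := by simpa using hP.isHermitian.eq
  have h1 := ciInf_le hbdd x
  have h2 := dot_act_nonneg hP x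
  have h3 := dot_act_nonneg hH d
  have h4 : 0 ≤ wSq L d / M := div_nonneg (wSq_nonneg (fun i => (hL i).le) _) (by simp)
  have h5 : 0 ≤ 9 * m * (dot x (act P x) + dot d (act H d) + wSq L d / M) := by positivity
  unfold potential
  rw [act_add, dot_add_left, dot_add_right, dot_add_right, dot_add_left, dot_act_symm hPt x y]
  linarith

theorem potential_initial_le (hL : ∀ i, 0 < L i) (hP : P.PosSemidef) (hm : 1 ≤ m)
    (hHL : ∀ v : Fin M → EuclideanSpace ℝ (Fin S), 80 * m * (wSq L v / M) ≤ dot v (act H v))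
    {x : Fin M → EuclideanSpace ℝ (Fin S)} (h : gradObj f 0 + act P x + act H x = 0) :
    potential f L P H m x x x ≤
      obj f x + 1 / (M : ℝ) * ∑ i, (L i)⁻¹ * ‖gradient (f i) 0‖ ^ 2 := by
  have e : dot x (gradObj f 0) + dot x (act P x) + dot x (act H x) = 0 := by
    rw [← dot_add_right, ← dot_add_right, h, dot_zero_right]
  have hm0 : 0 < m := by linarith
  -- The weight 80m in Young's inequality makes its first term at most half of the H-form of x.
  have hd := neg_dot_gradObj_le (f := f) hL (by positivity : 0 < 80 * m) 0 x
  have hw := hHL x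
  have hw0 : 0 ≤ wSq L x / M := div_nonneg (wSq_nonneg (fun i => (hL i).le) _) (by simp)
  have hP0 := dot_act_nonneg hP x
  have ha : 0 ≤ 1 / (M : ℝ) * ∑ i, (L i)⁻¹ * ‖gradient (f i) 0‖ ^ 2 :=
    mul_nonneg (by positivity) (Finset.sum_nonneg fun i _ =>
      mul_nonneg (inv_pos.2 (hL i)).le (sq_nonneg _))
  simp only [Pi.zero_apply] at hd
  unfold potential
  generalize 1 / (M : ℝ) * ∑ i, (L i)⁻¹ * ‖gradient (f i) 0‖ ^ 2 = a at *
  generalize wSq L x / M = w at *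
  generalize dot x (act P x) = p at *
  generalize dot x (act H x) = q at *
  have h1 : p + q ≤ 1 / (80 * m) * a := by
    have : 1 / (2 * (80 * m)) * a = 1 / 2 * (1 / (80 * m) * a) := by
      field_simp
    linarith
  have h2 : m * (p + q) ≤ a / 80 := by
    have := mul_le_mul_of_nonneg_left h1 hm0.le
    have h3 : m * (1 / (80 * m) * a) = a / 80 := by field_simp
    linarith
  have hq : 0 ≤ q := le_trans (by positivity) hw
  have h3 := mul_le_mul_of_nonneg_right hm (add_nonneg hP0 hq)
  have h4 := mul_le_mul_of_nonneg_right hm hw0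
  linarith

end Potential

/-! ### Two facts about real sequences -/

section Sequences

/-- An antitone sequence that dominates the increments of a nonnegative sequence is nonnegative,
stated relative to a constant. -/
theorem le_of_antitone_of_sub_le {p v : ℕ → ℝ} {a : ℝ} (hp : Antitone p) (hv : ∀ r, 0 ≤ v r)
    (h : ∀ r, a + v (r + 1) - v r ≤ p r) (k : ℕ) : a ≤ p k := by
  by_contra hcon
  rw [not_le] at hcon
  -- Once p lies below a, it stays there, and v loses at least the fixed amount a - p k at each
  -- step.
  have hsum : ∀ n : ℕ, v (k + n) ≤ v k - n * (a - p k) := fun n => by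
    induction n with
    | zero => simp
    | succ n ih =>
      have h1 := h (k + n)
      have h2 := hp (Nat.le_add_right k n)
      rw [← add_assoc]
      push_cast
      linarith
  obtain ⟨n, hn⟩ := exists_nat_gt (v k / (a - p k))
  rw [div_lt_iff₀ (by linarith)] at hn
  linarith [hsum n, hv (k + n)]

/-- Descent pairs s at k + 1 with h at k, whereas the gap needs both at the same index. Summing T +
1 steps and dropping h at 0 realigns them, leaving s at T + 1 over. -/
theorem sum_le_of_descent {p s h : ℕ → ℝ} (h0 : ∀ k, 0 ≤ h k)
    (hp : ∀ k, p (k + 1) ≤ p k - 1 / 2 * s (k + 1) - 1 / 2 * h k) (T : ℕ) :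
    ∑ k ∈ Finset.Icc 1 T, (s k + h k) + s (T + 1) ≤ 2 * (p 0 - p (T + 1)) := by
  induction T with
  | zero => simpa using by linarith [hp 0, h0 0]
  | succ T ih =>
    rw [Finset.sum_Icc_succ_top (by omega)]
    linarith [hp (T + 1)]

end Sequences

/-! ### Constraint violation, gap and averaged bound -/

section Convergence

variable {M S : ℕ} (G : SimpleGraph (Fin M)) [DecidableRel G.Adj] {L : Fin M → ℝ}

/-- The condition number `max{λ_max(W), 1} / min{λ_min(L_G), 1}`. -/
noncomputable def condNum (L : Fin M → ℝ) : ℝ :=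
  max (lamMax (matW G L)) 1 / min (lamMinNZ (matLG G L)) 1

theorem betaSq_eq : betaSq G L = 80 * condNum G L / M := by
  rw [betaSq, condNum, ← div_div, mul_div_assoc]

theorem one_le_condNum (hlam : 0 < lamMinNZ (matLG G L)) : 1 ≤ condNum G L := by
  rw [condNum, one_le_div (lt_min hlam one_pos)]
  exact (min_le_right _ _).trans (le_max_right _ _)

theorem div_lamMinNZ_le (hlam : 0 < lamMinNZ (matLG G L)) :
    (2 * max (lamMax (matW G L)) 1 + 1) / lamMinNZ (matLG G L) ≤ 3 * condNum G L := by
  have h1 := le_max_right (lamMax (matW G L)) 1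
  have h2 : (0 : ℝ) < min (lamMinNZ (matLG G L)) 1 := lt_min hlam one_pos
  rw [condNum, ← mul_div_assoc]
  exact div_le_div₀ (by positivity) (by linarith) h2 (min_le_left _ _)

theorem one_div_lamMinNZ_matLG_le (hlam : 0 < lamMinNZ (matLG G L)) :
    1 / lamMinNZ (matLG G L) ≤ condNum G L := by
  have h2 : (0 : ℝ) < min (lamMinNZ (matLG G L)) 1 := lt_min hlam one_pos
  exact div_le_div₀ (by positivity) (le_max_right _ _) h2 (min_le_left _ _)

variable {f : Fin M → EuclideanSpace ℝ (Fin S) → ℝ}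

/-- The constraint violation is controlled by the second difference of the iterates. -/
theorem dot_weightedLap_le_of_stationary (hM : 0 < M) (hL : ∀ i, 0 < L i)
    (hLip : ∀ i x z, ‖gradient (f i) x - gradient (f i) z‖ ≤ L i * ‖x - z‖)
    (hlam : 0 < lamMinNZ (matLG G L)) {b2 : ℝ} (hb : b2 = 80 * condNum G L / M)
    {x₀ x₁ x₂ y : Fin M → EuclideanSpace ℝ (Fin S)} {P H : Matrix (Fin M) (Fin M) ℝ}
    (hP : P = weightedLap G (sigmaPar G L b2))
    (hH : H = matH G (sigmaPar G L b2) (betaPar L b2))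
    (h₁ : gradObj f x₀ + act P y + act H (x₁ - x₀) = 0)
    (h₂ : gradObj f x₁ + act P (y + x₂) + act H (x₂ - x₁) = 0) :
    dot x₂ (act P x₂) ≤
      6 * condNum G L * dot (x₂ - x₁ - (x₁ - x₀)) (act H (x₂ - x₁ - (x₁ - x₀)))
      + 1 / 40 * (wSq L (x₁ - x₀) / M) := by
  have hm := one_le_condNum G hlam
  have hM0 : (0 : ℝ) < M := Nat.cast_pos.2 hM
  have hb0 : 0 < b2 := by rw [hb]; positivity
  have e : act P x₂ = (-1 : ℝ) • ((gradObj f x₁ - gradObj f x₀)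
      + act H (x₂ - x₁ - (x₁ - x₀))) := by
    rw [act_sub H]
    rw [act_add] at h₂
    have : act P x₂ = (gradObj f x₁ + (act P y + act P x₂) + act H (x₂ - x₁))
        - (gradObj f x₀ + act P y + act H (x₁ - x₀)) - ((gradObj f x₁ - gradObj f x₀)
        + (act H (x₂ - x₁) - act H (x₁ - x₀))) := by abel
    rw [this, h₁, h₂, sub_zero, zero_sub, neg_one_smul]
  have h3 := lamMinNZ_mul_le G hL hb0 x₂
  have hinv : ∀ i, 0 ≤ (b2 * L i)⁻¹ := fun i => (inv_pos.2 (mul_pos hb0 (hL i))).le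
  have h4 := wSq_add_le hinv (gradObj f x₁ - gradObj f x₀) (act H (x₂ - x₁ - (x₁ - x₀)))
  have h5 := wSq_inv_gradObj_sub_le hLip hL hb0 x₁ x₀
  have h6 := wSq_inv_act_matH_le G hL hb0 (x₂ - x₁ - (x₁ - x₀))
  rw [← hP, e, wSq_smul, ← e] at h3
  rw [← hH] at h6
  have hHpsd : H.PosSemidef := hH ▸ matH_posSemidef G _ _
  have hq := dot_act_nonneg hHpsd (x₂ - x₁ - (x₁ - x₀))
  have hw : 0 ≤ wSq L (x₁ - x₀) / M := div_nonneg (wSq_nonneg (fun i => (hL i).le) _) (by simp)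
  generalize dot (x₂ - x₁ - (x₁ - x₀)) (act H (x₂ - x₁ - (x₁ - x₀))) = q at *
  have h7 : 1 / (b2 * (M : ℝ) ^ 2) * wSq L (x₁ - x₀) =
      1 / (80 * condNum G L) * (wSq L (x₁ - x₀) / M) := by
    rw [hb]
    field_simp
  rw [h7] at h5
  have h8 := div_lamMinNZ_le G hlam
  have h9 := one_div_lamMinNZ_matLG_le G hlam
  generalize wSq L (x₁ - x₀) / M = w at *
  generalize condNum G L = m at *
  set c := 2 * max (lamMax (matW G L)) 1 + 1
  set l := lamMinNZ (matLG G L)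
  have h10 : l * dot x₂ (act P x₂) ≤ 2 * (1 / (80 * m) * w) + 2 * (c * q) := by linarith
  have h11 : dot x₂ (act P x₂) ≤ (2 * (1 / (80 * m) * w) + 2 * (c * q)) / l := by
    rw [le_div_iff₀ hlam]
    linarith
  -- The 2 from splitting the square meets c/λ ≤ 3m, giving 6m, and 1/λ ≤ m against 1/(80m), giving
  -- 1/40.
  calc dot x₂ (act P x₂) ≤ _ := h11
    _ = 2 * (c / l) * q + 1 / l * (1 / (40 * m) * w) := by
      field_simp
      ring
    _ ≤ 2 * (3 * m) * q + m * (1 / (40 * m) * w) := by gcongr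
    _ = 6 * m * q + 1 / 40 * w := by
      field_simp
      ring

/-- The columns of P sum to zero, so the averaged gradient is minus the block sum of Hd, which
Cauchy-Schwarz for H bounds. The violation enters the gap with coefficient 1, covered by the 4 in
C₂. -/
theorem gap_le {σ : G.edgeSet → ℝ} {β : Fin M → ℝ}
    {x₁ d y : Fin M → EuclideanSpace ℝ (Fin S)}
    (h : gradObj f x₁ + act (weightedLap G σ) y + act (matH G σ β) d = 0) :
    gap G f σ x₁ ≤ constC2 G σ β *
      (dot x₁ (act (weightedLap G σ) x₁) + dot d (act (matH G σ β) d)) := by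
  have h1 : (1 / (M : ℝ)) • ∑ i, gradient (f i) (x₁ i) = -∑ i, act (matH G σ β) d i := by
    have h2 : ∑ i, (gradObj f x₁ + act (weightedLap G σ) y + act (matH G σ β) d) i = 0 := by
      rw [h]
      simp
    simp only [Pi.add_apply, Finset.sum_add_distrib, sum_act_weightedLap, add_zero] at h2
    rw [Finset.smul_sum]
    exact eq_neg_of_add_eq_zero_left h2
  have h2 := norm_sum_act_matH_sq_le G σ β d
  have h3 := dot_act_nonneg (matH_posSemidef G σ β) d
  have h4 := dot_act_nonneg (weightedLap_posSemidef G σ) x₁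
  have h5 : 0 ≤ 4 * ∑ e, σ e ^ 2 + ∑ i, β i ^ 2 := by positivity
  rw [gap, h1, norm_neg, sqNorm_incF, constC2]
  nlinarith [mul_nonneg h5 h4]

/-- The averaged gap along the iterates of D-GPDA. -/
theorem sum_gap_le (hM : 0 < M) (hf : ∀ i, Differentiable ℝ (f i)) (hL : ∀ i, 0 < L i)
    (hLip : ∀ i x z, ‖gradient (f i) x - gradient (f i) z‖ ≤ L i * ‖x - z‖)
    (hbdd : BddBelow (Set.range (obj f))) (hlam : 0 < lamMinNZ (matLG G L))
    {σ : G.edgeSet → ℝ} (hσ : σ = sigmaPar G L (betaSq G L))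
    {β : Fin M → ℝ} (hβ : β = betaPar L (betaSq G L))
    {x : ℕ → Fin M → EuclideanSpace ℝ (Fin S)} {lam : ℕ → G.edgeSet → EuclideanSpace ℝ (Fin S)}
    (hx : IsDGPDA G f σ β x lam) (T : ℕ) :
    ∑ r ∈ Finset.Icc 1 T, gap G f σ (x r) ≤ 2 * constC2 G σ β * (obj f (x 0) - (⨅ y, obj f y)
      + 1 / (M : ℝ) * ∑ i, (L i)⁻¹ * ‖gradient (f i) 0‖ ^ 2) := by
  have hm := one_le_condNum G hlam
  have hM0 : (0 : ℝ) < M := Nat.cast_pos.2 hM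
  have hb := betaSq_eq G (L := L)
  have hb0 : 0 < betaSq G L := by rw [hb]; positivity
  have hP := weightedLap_posSemidef G σ
  have hH := matH_posSemidef G σ β
  have hHL : ∀ v : Fin M → EuclideanSpace ℝ (Fin S),
      80 * condNum G L * (wSq L v / M) ≤ dot v (act (matH G σ β) v) := fun v => by
    have h := wSq_le_dot_matH G hL hb0 v
    rw [← hσ, ← hβ, hb] at h
    calc _ = _ := by ring
      _ ≤ _ := h
  have hPeq : weightedLap G σ = weightedLap G (sigmaPar G L (betaSq G L)) := by rw [hσ]
  have hHeq : matH G σ β = matH G (sigmaPar G L (betaSq G L)) (betaPar L (betaSq G L)) := by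
    rw [hσ, hβ]
  have hst := hx.stationary_succ
  have hst0 := hx.stationary_zero
  set Lap := weightedLap G σ
  set H := matH G σ β
  set y := runningSum x
  have hys : ∀ r, y (r + 1) = y r + x r := runningSum_succ x
  have hy1 : y 1 = x 0 := by simp [y, runningSum]
  -- the iterate before `x 0` is `0`
  let xp : ℕ → Fin M → EuclideanSpace ℝ (Fin S) := fun r => r.casesOn 0 x
  have hprev : ∀ r, gradObj f (xp r) + act Lap (y (r + 1)) + act H (x r - xp r) = 0 := fun r => by
    cases r with
    | zero => rw [hy1]; simpa [xp] using hst0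
    | succ r => rw [hys (r + 1)]; exact hst r
  let p : ℕ → ℝ := fun r => potential f L Lap H (condNum G L) (y (r + 1)) (x r) (x r - xp r)
  have hstep : ∀ k, p (k + 1) ≤ p k - 1 / 2 * dot (x (k + 1)) (act Lap (x (k + 1)))
      - 1 / 2 * dot (x (k + 1) - x k) (act H (x (k + 1) - x k)) := fun k => by
    have h := potential_step hf hL hLip hP hH hm hHL (hprev k) (hst k)
      (dot_weightedLap_le_of_stationary G hM hL hLip hlam hb hPeq hHeq (hprev k) (hst k))
    simp only [p]
    rw [hys (k + 1)]
    exact h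
  have hs0 : ∀ k, 0 ≤ dot (x k) (act Lap (x k)) := fun k => dot_act_nonneg hP _
  have hh0 : ∀ k, 0 ≤ dot (x (k + 1) - x k) (act H (x (k + 1) - x k)) :=
    fun k => dot_act_nonneg hH _
  have hlow : ∀ k, (⨅ z, obj f z) ≤ p k := by
    refine le_of_antitone_of_sub_le (v := fun r => 1 / 2 * dot (y r) (act Lap (y r)))
      (antitone_nat_of_succ_le fun k => ?_) (fun r => ?_) fun r => ?_
    · linarith [hstep k, hs0 (k + 1), hh0 k]
    · have := dot_act_nonneg hP (y r)
      positivity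
    · have h := le_potential (m := condNum G L) hL hP hH (by linarith) hbdd (y r) (x r)
        (x r - xp r)
      simp only [p]
      rw [hys r]
      exact h
  have hinit : p 0 ≤ obj f (x 0) + 1 / (M : ℝ) * ∑ i, (L i)⁻¹ * ‖gradient (f i) 0‖ ^ 2 := by
    have h := potential_initial_le hL hP hm hHL hst0
    simp only [p, zero_add, hy1]
    rw [show xp 0 = 0 from rfl, sub_zero]
    exact h
  have hC : 0 ≤ constC2 G σ β := by unfold constC2; positivity
  have hsum := sum_le_of_descent (p := p) (s := fun k => dot (x k) (act Lap (x k))) hh0 hstep T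
  calc ∑ r ∈ Finset.Icc 1 T, gap G f σ (x r)
      ≤ ∑ r ∈ Finset.Icc 1 T, constC2 G σ β * (dot (x r) (act Lap (x r))
          + dot (x (r + 1) - x r) (act H (x (r + 1) - x r))) :=
        Finset.sum_le_sum fun r _ => gap_le G (hst r)
    _ = constC2 G σ β * ∑ r ∈ Finset.Icc 1 T, (dot (x r) (act Lap (x r))
          + dot (x (r + 1) - x r) (act H (x (r + 1) - x r))) := by rw [Finset.mul_sum]
    _ ≤ constC2 G σ β * (2 * (obj f (x 0) - (⨅ y, obj f y)
          + 1 / (M : ℝ) * ∑ i, (L i)⁻¹ * ‖gradient (f i) 0‖ ^ 2)) := by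
        refine mul_le_mul_of_nonneg_left ?_ hC
        linarith [hs0 (T + 1), hlow (T + 1)]
    _ = _ := by ring

theorem gap_nonneg (σ : G.edgeSet → ℝ) (z : Fin M → EuclideanSpace ℝ (Fin S)) :
    0 ≤ gap G f σ z :=
  add_nonneg (sq_nonneg _) (sqNorm_nonneg _)

theorem mul_errorMeasure_le (σ : G.edgeSet → ℝ) (x : ℕ → Fin M → EuclideanSpace ℝ (Fin S))
    (T : ℕ) : T * errorMeasure G f σ x T ≤ ∑ r ∈ Finset.Icc 1 T, gap G f σ (x r) := by
  have h : ∀ r ∈ Finset.Icc 1 T, errorMeasure G f σ x T ≤ gap G f σ (x r) := fun r hr =>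
    ciInf_le (f := fun r : Finset.Icc 1 T => gap G f σ (x r))
      ⟨0, by rintro _ ⟨s, rfl⟩; exact gap_nonneg G σ _⟩ ⟨r, hr⟩
  simpa using Finset.card_nsmul_le_sum _ _ _ h

end Convergence

/-! ### Descent conditions, the constant and the iteration count -/

section Parameters

variable {M : ℕ} (G : SimpleGraph (Fin M)) [DecidableRel G.Adj] {L : Fin M → ℝ}

theorem kappa_le (hM : 0 < M) (hL : ∀ i, 0 < L i) (hlam : 0 < lamMinNZ (matLG G L)) :
    kappa G (sigmaPar G L (betaSq G L)) (betaPar L (betaSq G L)) ≤ 3 * condNum G L := by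
  have hm := one_le_condNum G hlam
  have hM0 : (0 : ℝ) < M := Nat.cast_pos.2 hM
  have hb0 : 0 < betaSq G L := by rw [betaSq_eq]; positivity
  exact (kappa_par_le G hL hb0 hlam).trans (div_lamMinNZ_le G hlam)

theorem diagonal_mul_inv_mul_diagonal (hL : ∀ i, 0 < L i) {b2 : ℝ} (hb : 0 < b2) :
    Matrix.diagonal L * (Matrix.diagonal (betaPar L b2) ^ 2)⁻¹ * Matrix.diagonal L =
      Matrix.diagonal fun i => L i / b2 := by
  have h : (Matrix.diagonal (betaPar L b2) ^ 2)⁻¹ = Matrix.diagonal fun i => (b2 * L i)⁻¹ := by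
    refine Matrix.inv_eq_right_inv ?_
    rw [Matrix.diagonal_pow, Matrix.diagonal_mul_diagonal, ← Matrix.diagonal_one]
    congr 1
    funext i
    rw [Pi.pow_apply, betaPar_sq hL hb.le]
    exact mul_inv_cancel₀ (mul_pos hb (hL i)).ne'
  rw [h, Matrix.diagonal_mul_diagonal, Matrix.diagonal_mul_diagonal]
  congr 1
  funext i
  have := hL i
  field_simp

theorem descent_condition_one (hM : 0 < M) (hL : ∀ i, 0 < L i)
    (hlam : 0 < lamMinNZ (matLG G L)) {β : Fin M → ℝ} (hβ : β = betaPar L (betaSq G L)) :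
    (Matrix.diagonal β ^ 2 - (1 / (M : ℝ) ^ 2) •
      (Matrix.diagonal L * (Matrix.diagonal β ^ 2)⁻¹ * Matrix.diagonal L)).PosSemidef := by
  have hm := one_le_condNum G hlam
  have hM0 : (0 : ℝ) < M := Nat.cast_pos.2 hM
  have hb := betaSq_eq G (L := L)
  have hb0 : 0 < betaSq G L := by rw [hb]; positivity
  subst hβ
  rw [diagonal_mul_inv_mul_diagonal hL hb0, Matrix.diagonal_pow, ← Matrix.diagonal_smul,
    Matrix.diagonal_sub]
  refine Matrix.PosSemidef.diagonal fun i => ?_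
  simp only [Pi.zero_apply, Pi.smul_apply, Pi.pow_apply, smul_eq_mul]
  rw [betaPar_sq hL hb0.le, hb]
  have hLi := hL i
  have h : 80 * condNum G L / M * L i - 1 / (M : ℝ) ^ 2 * (L i / (80 * condNum G L / M)) =
      L i / M * (80 * condNum G L - 1 / (80 * condNum G L)) := by
    field_simp
  rw [h]
  have h1 : 1 / (80 * condNum G L) ≤ 1 := by
    rw [div_le_one (by positivity)]
    linarith
  exact mul_nonneg (by positivity) (by linarith)

/-- Everything is diagonal, and up to the nonnegative Δ/2 each entry is L_i/M times 40m - 1 -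
κ/(20m) - 2c. Here κ ≤ 3m gives c ≤ 18m, so the factor 80 in β² leaves at least 4m - 2. -/
theorem descent_condition_two (hM : 0 < M) (hL : ∀ i, 0 < L i)
    (hlam : 0 < lamMinNZ (matLG G L)) (σ : G.edgeSet → ℝ) {β : Fin M → ℝ}
    (hβ : β = betaPar L (betaSq G L)) {κ : ℝ} (hκ : κ ≤ 3 * condNum G L) :
    ((1 / 2 : ℝ) • (deltaMat G σ + Matrix.diagonal β ^ 2) - (1 / (M : ℝ)) • Matrix.diagonal L
      - (4 * κ / (M : ℝ) ^ 2) •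
        (Matrix.diagonal L * (Matrix.diagonal β ^ 2)⁻¹ * Matrix.diagonal L)
      - (2 * max (6 * κ) 1 / (M : ℝ)) • Matrix.diagonal L).PosSemidef := by
  have hm := one_le_condNum G hlam
  have hM0 : (0 : ℝ) < M := Nat.cast_pos.2 hM
  have hb := betaSq_eq G (L := L)
  have hb0 : 0 < betaSq G L := by rw [hb]; positivity
  subst hβ
  rw [diagonal_mul_inv_mul_diagonal hL hb0, Matrix.diagonal_pow, deltaMat, Matrix.diagonal_add]
  simp only [← Matrix.diagonal_smul, Matrix.diagonal_sub]
  refine Matrix.PosSemidef.diagonal fun i => ?_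
  simp only [Pi.zero_apply, Pi.smul_apply, Pi.pow_apply, smul_eq_mul]
  rw [betaPar_sq hL hb0.le, hb]
  have hLi := hL i
  have hδ : 0 ≤ ∑ e : G.edgeSet, if i ∈ e.1 then σ e ^ 2 else 0 :=
    Finset.sum_nonneg fun e _ => by split_ifs <;> positivity
  have hc : max (6 * κ) 1 ≤ 18 * condNum G L := max_le (by linarith) (by linarith)
  generalize condNum G L = m at *
  generalize max (6 * κ) 1 = c at *
  have h : 1 / 2 * ((∑ e : G.edgeSet, if i ∈ e.1 then σ e ^ 2 else 0) + 80 * m / M * L i)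
      - 1 / M * L i - 4 * κ / (M : ℝ) ^ 2 * (L i / (80 * m / M)) - 2 * c / M * L i =
      1 / 2 * (∑ e : G.edgeSet, if i ∈ e.1 then σ e ^ 2 else 0) +
        L i / M * (40 * m - 1 - κ / (20 * m) - 2 * c) := by
    field_simp
    ring
  rw [h]
  have h1 : κ / (20 * m) ≤ 1 := by
    rw [div_le_one (by positivity)]
    linarith
  have h2 : 0 ≤ L i / M * (40 * m - 1 - κ / (20 * m) - 2 * c) :=
    mul_nonneg (by positivity) (by linarith)
  linarith

theorem constC2_par (hM : 0 < M) (hL : ∀ i, 0 < L i) (hlam : 0 < lamMinNZ (matLG G L)) :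
    constC2 G (sigmaPar G L (betaSq G L)) (betaPar L (betaSq G L)) =
      320 * condNum G L *
        (∑ e, edgeWeight G L e / (M : ℝ) + 1 / (M : ℝ) * (∑ i, L i) / 4) + 4 := by
  have hm := one_le_condNum G hlam
  have hM0 : (0 : ℝ) < M := Nat.cast_pos.2 hM
  have hb := betaSq_eq G (L := L)
  have hb0 : 0 < betaSq G L := by rw [hb]; positivity
  simp only [constC2, sigmaPar_sq G L _ hb0.le, betaPar_sq hL hb0.le, ← Finset.mul_sum,
    ← Finset.sum_div]
  rw [hb]
  field_simp
  ring

/-- The iteration count: a running average bound with a factor of two to spare also covers the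
integer part of `N`. -/
theorem exists_and_forall_of_mul_le {e : ℕ → ℝ} {ε N : ℝ} (hN : 0 ≤ N)
    (h : ∀ T : ℕ, T * e T ≤ ε * N / 2) (hε : 0 < ε) :
    (∃ T : ℕ, 1 ≤ T ∧ (T : ℝ) ≤ max 1 N ∧ e T ≤ ε) ∧
      ∀ T : ℕ, 1 ≤ T → N ≤ (T : ℝ) → e T ≤ ε := by
  have key : ∀ T : ℕ, 1 ≤ T → N ≤ 2 * (T : ℝ) → e T ≤ ε := fun T hT hNT => by
    have hT0 : (0 : ℝ) < T := by exact_mod_cast hT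
    refine le_of_mul_le_mul_left ((h T).trans ?_) hT0
    nlinarith
  refine ⟨?_, fun T hT hNT => key T hT (by linarith [hN])⟩
  rcases le_total N 1 with h1 | h1
  · exact ⟨1, le_rfl, by simp, key 1 le_rfl (by norm_num; linarith)⟩
  -- For N ≥ 1 the integer part satisfies N < ⌊N⌋ + 1 ≤ 2⌊N⌋, which is all that `key` asks for.
  · have hf : 1 ≤ ⌊N⌋₊ := Nat.one_le_floor_iff _ |>.2 h1
    have hf' : (1 : ℝ) ≤ ⌊N⌋₊ := by exact_mod_cast hf
    refine ⟨⌊N⌋₊, hf, (Nat.floor_le hN).trans (le_max_right _ _), key _ hf ?_⟩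
    linarith [(Nat.lt_floor_add_one N).le]

end Parameters
end DGPDA

/-! ### Assembly of the theorem -/

theorem theorem6p1 {M S : ℕ} (hM : 2 ≤ M)
    (G : SimpleGraph (Fin M)) [DecidableRel G.Adj] (hG : G.Connected)
    (f : Fin M → EuclideanSpace ℝ (Fin S) → ℝ) (hf : ∀ i, Differentiable ℝ (f i))
    (L : Fin M → ℝ) (hL : ∀ i, 0 < L i)
    (hLip : ∀ i x z, ‖gradient (f i) x - gradient (f i) z‖ ≤ L i * ‖x - z‖)
    (hbdd : BddBelow (Set.range (DGPDA.obj f)))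
    (σ : G.edgeSet → ℝ) (hσ : σ = DGPDA.sigmaPar G L (DGPDA.betaSq G L))
    (β : Fin M → ℝ) (hβ : β = DGPDA.betaPar L (DGPDA.betaSq G L))
    (x : ℕ → Fin M → EuclideanSpace ℝ (Fin S))
    (lam : ℕ → G.edgeSet → EuclideanSpace ℝ (Fin S))
    (hx : DGPDA.IsDGPDA G f σ β x lam)
    (κ : ℝ) (hκ : κ = DGPDA.kappa G σ β) (c : ℝ) (hc : c = max (6 * κ) 1)
    (Lmat : Matrix (Fin M) (Fin M) ℝ) (hLmat : Lmat = Matrix.diagonal L)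
    (Ups2 : Matrix (Fin M) (Fin M) ℝ) (hUps2 : Ups2 = Matrix.diagonal β ^ 2)
    (C₂ : ℝ) (hC₂ : C₂ = DGPDA.constC2 G σ β)
    (A : ℝ) (hA : A = 320 * max (DGPDA.lamMax (DGPDA.matW G L)) 1 /
      min (DGPDA.lamMinNZ (DGPDA.matLG G L)) 1)
    (Lbar : ℝ) (hLbar : Lbar = (1 / (M : ℝ)) * ∑ i, L i) :
    -- the descent conditions
    (Ups2 - (1 / (M : ℝ) ^ 2) • (Lmat * Ups2⁻¹ * Lmat)).PosSemidef ∧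
    ((1 / 2 : ℝ) • (DGPDA.deltaMat G σ + Ups2) - (1 / (M : ℝ)) • Lmat
      - (4 * κ / (M : ℝ) ^ 2) • (Lmat * Ups2⁻¹ * Lmat)
      - (2 * c / (M : ℝ)) • Lmat).PosSemidef ∧
    -- the iteration bound
    (∀ ε : ℝ, 0 < ε → ∀ N : ℝ,
      N = 8 / ε * (DGPDA.obj f (x 0) - (⨅ y, DGPDA.obj f y)
        + 2 / (M : ℝ) * ∑ i, (L i)⁻¹ * ‖gradient (f i) 0‖ ^ 2) * C₂ →
      (∃ T : ℕ, 1 ≤ T ∧ (T : ℝ) ≤ max 1 N ∧ DGPDA.errorMeasure G f σ x T ≤ ε) ∧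
      ∀ T : ℕ, 1 ≤ T → N ≤ (T : ℝ) → DGPDA.errorMeasure G f σ x T ≤ ε) ∧
    -- the constant
    C₂ = A * (∑ e, DGPDA.edgeWeight G L e / (M : ℝ) + Lbar / 4) + 4 ∧
    C₂ ≤ A * ∑ e, (DGPDA.edgeWeight G L e / (M : ℝ) + Lbar / 4) + 4 := by
  have hM0 : 0 < M := by omega
  have hM1 : (0 : ℝ) < M := Nat.cast_pos.2 hM0
  have hlam := DGPDA.lamMinNZ_matLG_pos G hM hG hL
  have hm := DGPDA.one_le_condNum G hlam
  have hκ' : κ ≤ 3 * DGPDA.condNum G L := by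
    rw [hκ, hσ, hβ]
    exact DGPDA.kappa_le G hM0 hL hlam
  have hA' : A = 320 * DGPDA.condNum G L := by rw [hA, DGPDA.condNum, mul_div_assoc]
  have hC : C₂ = A * (∑ e, DGPDA.edgeWeight G L e / (M : ℝ) + Lbar / 4) + 4 := by
    rw [hC₂, hσ, hβ, hA', hLbar, DGPDA.constC2_par G hM0 hL hlam]
  have hLbar0 : 0 ≤ Lbar := by
    rw [hLbar]
    exact mul_nonneg (by positivity) (Finset.sum_nonneg fun i _ => (hL i).le)
  subst hc hLmat hUps2
  refine ⟨DGPDA.descent_condition_one G hM0 hL hlam hβ,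
    DGPDA.descent_condition_two G hM0 hL hlam σ hβ hκ', fun ε hε N hN => ?_, hC, ?_⟩
  · have hC0 : 0 ≤ C₂ := by
      rw [hC₂, DGPDA.constC2]
      positivity
    have hgap : 0 ≤ DGPDA.obj f (x 0) - ⨅ y, DGPDA.obj f y := sub_nonneg.2 (ciInf_le hbdd _)
    have hd : 0 ≤ 1 / (M : ℝ) * ∑ i, (L i)⁻¹ * ‖gradient (f i) 0‖ ^ 2 :=
      mul_nonneg (by positivity) (Finset.sum_nonneg fun i _ =>
        mul_nonneg (inv_pos.2 (hL i)).le (sq_nonneg _))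
    have hN' : ε * N = 8 * (DGPDA.obj f (x 0) - (⨅ y, DGPDA.obj f y)
        + 2 * (1 / (M : ℝ) * ∑ i, (L i)⁻¹ * ‖gradient (f i) 0‖ ^ 2)) * C₂ := by
      rw [hN]
      field_simp
    refine DGPDA.exists_and_forall_of_mul_le ?_ (fun T => ?_) hε
    · refine nonneg_of_mul_nonneg_right ?_ hε
      rw [hN']
      positivity
    · have h1 := DGPDA.mul_errorMeasure_le (f := f) G σ x T
      have h2 := DGPDA.sum_gap_le G hM0 hf hL hLip hbdd hlam hσ hβ hx T
      rw [← hC₂] at h2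
      rw [hN']
      refine (h1.trans h2).trans ?_
      -- Half of εN has prefactor 4 and twice the d₀ term, while the averaged bound needs prefactor
      -- 2 and one such term.
      nlinarith [mul_nonneg hC0 hgap, mul_nonneg hC0 hd]
  · have hA0 : 0 ≤ A := by rw [hA']; positivity
    -- Moving the mean Lipschitz constant inside the sum repeats it once per edge, so at least one
    -- edge is needed.
    have hE : (1 : ℝ) ≤ Fintype.card G.edgeSet := by
      have := DGPDA.exists_edge G hM hG
      exact_mod_cast Fintype.card_pos
    rw [hC, Finset.sum_add_distrib, Finset.sum_const, Finset.card_univ, nsmul_eq_mul]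
    have : Lbar / 4 ≤ Fintype.card G.edgeSet * (Lbar / 4) :=
      le_mul_of_one_le_left (by positivity) hE
    gcongr
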